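/- Consider the asymmetric external memory model with primary memory of size $\Theta(M)$ and blocks of size $B$ (both measured in records), in which reads and writes of blocks between primary and secondary memory are counted and computation in primary memory is free. Let $k\ge 1$ be an integer, let $B\ge 1$ divide $M$, and let $l=kM/B\ge 8$. A buffer tree with branching factor $l$ is an $(a,b)$-tree with $a=l/4$, $b=l$: all leaves have the same depth, every internal node has between $l/4$ and $l$ children (a root that is internal may have fewer, but at least $2$) whose subtrees are separated by sorted keys, and every leaf holds between $lB/4$ and $lB$ sorted records in at most $l$ blocks (a root that is a leaf may hold fewer records). Moreover every node has a buffer, a dense list of blocks of records that belong to its subtree. A node is full when its buffer holds at least $lB$ records. The last, partial block of the root's buffer is kept in primary memory. A record is inserted by appending it to the root's buffer. If this makes the root full, then: 1. As long as there is a full internal node, it is emptied: the first $lB$ records of its buffer are sorted by a selection sort with $k$ scans, each of which outputs the next $M$ records, and they are merged with the remaining records of the buffer (which are already sorted) while being appended to the buffers of the children. 2. Then the buffer of every full leaf is sorted in the same way and merged with the records of the leaf; a leaf with more than $lB$ records is split evenly, and so, going up the tree, is every internal node that now has more than $l$ children; new roots are added as needed. Theorem. There is an absolute constant $C$ such that for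 all such $k,M,B$, every $n\ge 0$ and every sequence of $n$ insertions of distinct keys into the initially empty tree, the result is a buffer tree with branching factor $l$ holding exactly the inserted records, none of whose nodes is full, and the insertions together perform at most $$C\,n\,\frac{k}{B}\bigl(1+\log_{kM/B}n\bigr)\ \text{reads}\quad\text{and}\quad C\,n\,\frac{1}{B}\bigl(1+\log_{kM/B}n\bigr)\ \text{writes}$$ (both bounds being $0$ for $n=0$), while never using more than $C\,M$ locations of primary memory; between insertions only the partial last block of the root's buffer occupies primary memory (references and $O(1)$ bookkeeping words not counted). That is, each insertion costs amortized $O((k/B)(1+\log_{kM/B}n))$ reads and $O((1/B)(1+\log_{kM/B}n))$ writes. -/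

import Mathlib

universe u

namespace AEM

/-! ### The asymmetric external memory model

Programs are written in a state monad that meters block transfers and the occupancy of primary
memory. Data in secondary memory lives in cells `Stored α`; the only operations of a program that
look inside a cell or make a new one are `load` (one read) and `store` (one write). A program may
hold, copy and relink references to cells. Computation in primary memory is free. -/

/-- The meter: numbers of block reads and block writes so far, the number of locations of primary
memory occupied now, and the maximum of that number so far. -/
structure Meter where
  reads : ℕ
  writes : ℕ
  held : ℤ
  peak : ℤ

/-- The meter at the start of a computation, with empty primary memory. -/
def Meter.zero : Meter := ⟨0, 0, 0, 0⟩

/-- Programs of the model with result in `α`. -/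
def Prog (α : Type u) : Type u := Meter → α × Meter

instance : Monad Prog.{u} where
  pure a := fun m => (a, m)
  bind p f := fun m => f (p m).1 (p m).2

/-- A cell (one block) of secondary memory. -/
structure Stored (α : Type u) : Type u where
  contents : α

/-- Number of locations that a value of `α` takes up in primary memory. -/
class Footprint (α : Type u) where
  words : α → ℕ

/-- A list of records takes one location for each record. -/
instance (K : Type u) : Footprint (List K) := ⟨List.length⟩

/-- `n` locations of primary memory are taken into use. -/
def occupy (n : ℕ) : Prog PUnit.{u+1} := fun m =>
  (⟨⟩, { m with held := m.held + n, peak := max m.peak (m.held + n) })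

/-- `n` locations of primary memory are given up, at no cost. -/
def release (n : ℕ) : Prog PUnit.{u+1} := fun m => (⟨⟩, { m with held := m.held - n })

/-- The read instruction: the contents of a cell are copied to primary memory. -/
def load {α : Type u} [Footprint α] (c : Stored α) : Prog α := fun m =>
  (c.contents,
    { reads := m.reads + 1
      writes := m.writes
      held := m.held + Footprint.words c.contents
      peak := max m.peak (m.held + Footprint.words c.contents) })

/-- The write instruction: a value leaves primary memory for a cell of secondary memory. -/
def store {α : Type u} [Footprint α] (a : α) : Prog (Stored α) := fun m =>
  (⟨a⟩,
    { reads := m.reads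
      writes := m.writes + 1
      held := m.held - Footprint.words a
      peak := m.peak })

/-- Move one location of bookkeeping to a work list in secondary memory. -/
def save : Prog PUnit.{u+1} := fun m =>
  (⟨⟩, { m with writes := m.writes + 1, held := m.held - 1 })

/-- Fetch one location of bookkeeping back from a work list in secondary memory. -/
def restore : Prog PUnit.{u+1} := fun m =>
  (⟨⟩, { m with reads := m.reads + 1, held := m.held + 1, peak := max m.peak (m.held + 1) })

/-- Run a program on every entry of a list, from left to right. -/
def forEach {α β : Type u} (f : α → Prog β) : List α → Prog (List β)
  | [] => pure []
  | a :: as => do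
      let b ← f a
      let bs ← forEach f as
      pure (b :: bs)

/-- The parameters: primary memory size `M` and block size `B`, both counted in records, and the
extra branching factor `k`. -/
structure Params where
  k : ℕ
  M : ℕ
  B : ℕ

/-- The branching factor `l = kM/B`. -/
def Params.l (P : Params) : ℕ := P.k * P.M / P.B

section Files

variable {K : Type u} [LinearOrder K]

/-- A block of records. A sequence of records is kept as a list of blocks. -/
abbrev Block (K : Type u) : Type u := Stored (List K)

/-- The records in a list of blocks. -/
def contentsOf (bs : List (Block K)) : List K := (bs.map Stored.contents).flatten

/-- `ys` in increasing order, cut off after the `m` smallest records. -/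
def smallest (m : ℕ) (ys : List K) : List K := (ys.insertionSort (· ≤ ·)).take m

/-- One phase of selection sort: a scan that retains in primary memory the `M` smallest records
seen so far among those above `last` (the largest record output in earlier phases, if any). -/
def scan (P : Params) (last : WithBot K) : List (Block K) → List K → Prog (List K)
  | [], acc => pure acc
  | b :: bs, acc => do
      let xs ← load b
      let acc' := smallest P.M (acc ++ xs.filter (fun x : K => last < (x : WithBot K)))
      release (acc.length + xs.length - acc'.length)
      scan P last bs acc'

/-- Write records held in primary memory to at most `n` new blocks of size `B`. -/
def writeOut (P : Params) : ℕ → List K → Prog (List (Block K))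
  | 0, _ => pure []
  | n + 1, ys =>
      if ys = [] then pure []
      else do
        let b ← store (ys.take P.B)
        let bs ← writeOut P n (ys.drop P.B)
        pure (b :: bs)

/-- Selection sort in the given number of phases, each of which outputs the next `M` records. -/
def selectionSort (P : Params) : ℕ → WithBot K → List (Block K) → Prog (List (Block K))
  | 0, _, _ => pure []
  | r + 1, last, bs => do
      let ys ← scan P last bs []
      let out ← writeOut P (P.M / P.B) ys
      let rest ← selectionSort P r (ys.getLast? : Option K) bs
      pure (out ++ rest)

/-- A sequential reader: the unread rest of the block in primary memory, and the blocks to come. -/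
structure Reader (K : Type u) : Type u where
  cur : List K
  rest : List (Block K)

/-- Start reading a list of blocks. -/
def Reader.start (bs : List (Block K)) : Reader K := ⟨[], bs⟩

/-- Load the next block if the current one is used up. -/
def Reader.refill (s : Reader K) : Prog (Reader K) :=
  match s.cur, s.rest with
  | [], b :: bs => do
      let xs ← load b
      pure ⟨xs, bs⟩
  | _, _ => pure s

/-- Two readers that are being merged. -/
abbrev Pair (K : Type u) : Type u := Reader K × Reader K

/-- Take the smaller of the two next records, provided that it is at most `u`. -/
def pull (u : WithTop K) (p : Pair K) : Prog (Option K × Pair K) := do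
  let s ← p.1.refill
  let t ← p.2.refill
  match s.cur, t.cur with
  | [], [] => pure (none, (s, t))
  | x :: xs, [] =>
      if (x : WithTop K) ≤ u then pure (some x, (⟨xs, s.rest⟩, t)) else pure (none, (s, t))
  | [], y :: ys =>
      if (y : WithTop K) ≤ u then pure (some y, (s, ⟨ys, t.rest⟩)) else pure (none, (s, t))
  | x :: xs, y :: ys =>
      if x ≤ y then
        if (x : WithTop K) ≤ u then pure (some x, (⟨xs, s.rest⟩, t)) else pure (none, (s, t))
      else
        if (y : WithTop K) ≤ u then pure (some y, (s, ⟨ys, t.rest⟩)) else pure (none, (s, t))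

/-- Take records that are at most `u` from the merge, as long as there are any but at most `n`. -/
def pullMany (u : WithTop K) : ℕ → Pair K → Prog (List K × Pair K)
  | 0, p => pure ([], p)
  | n + 1, p => do
      let r ← pull u p
      match r.1 with
      | none => pure ([], r.2)
      | some x => do
          let q ← pullMany u n r.2
          pure (x :: q.1, q.2)

/-- Write all records of the merge that are at most `u` to new blocks. The number is a bound on the
iterations of the loop. The program also returns how many records it wrote. -/
def emit (P : Params) (u : WithTop K) : ℕ → Pair K → Prog (List (Block K) × ℕ × Pair K)
  | 0, p => pure ([], 0, p)
  | n + 1, p => do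
      let q ← pullMany u P.B p
      if q.1 = [] then pure ([], 0, q.2)
      else do
        let b ← store q.1
        let r ← emit P u n q.2
        pure (b :: r.1, q.1.length + r.2.1, r.2.2)

/-- Merge two sorted sequences, of `n` records or fewer together, to a new sequence of blocks. -/
def mergeFiles (P : Params) (n : ℕ) (as bs : List (Block K)) : Prog (List (Block K)) := do
  let r ← emit P ⊤ n (Reader.start as, Reader.start bs)
  pure r.1

end Files

/-! ### The buffer tree -/

/-- The header of a node: the largest key that belongs to its subtree (`⊤` if there is no bound),
the list of blocks of its buffer and the number `size` of records in the buffer, the mark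
`emptied`, which an internal node carries while it has been emptied in the current
buffer-emptying process but has not been rebalanced yet, and the node's `body`. The keys of an
internal node are the bounds `upper` of its children other than the last. -/
structure Node (K σ : Type u) : Type u where
  upper : WithTop K
  buf : List (Block K)
  size : ℕ
  emptied : Bool
  body : σ

/-- A header is a bounded number of words and is counted as one location. -/
instance (K σ : Type u) : Footprint (Node K σ) := ⟨fun _ => 1⟩

/-- The body of a leaf (height `0`) is the list of blocks with its records; the body of an internal
node is the list of its children, whose height is one less. -/
@[reducible]
def Body (K : Type u) : ℕ → Type u
  | 0 => List (Block K)
  | h + 1 => List (Stored (Node K (Body K h)))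

/-- Nodes of height `h`: all leaves below such a node are at depth `h`. -/
abbrev Tree (K : Type u) (h : ℕ) : Type u := Node K (Body K h)

section Insertion

variable {K : Type u} [LinearOrder K]

/-- Append to the buffer of `v` the records of the merge that belong to `v`: first fill up the last
block of the buffer if it is partial, then append new blocks. -/
def appendTo (P : Params) {σ : Type u} (n : ℕ) (v : Node K σ) (p : Pair K) :
    Prog (Node K σ × Pair K) :=
  match v.buf.getLast?, v.size % P.B with
  | some c, _ + 1 => do
      let ys ← load c
      let q ← pullMany v.upper (P.B - ys.length) p
      let b ← store (ys ++ q.1)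
      let r ← emit P v.upper n q.2
      pure ({ v with buf := v.buf.dropLast ++ (b :: r.1), size := v.size + (q.1.length + r.2.1) },
        r.2.2)
  | _, _ => do
      let r ← emit P v.upper n p
      pure ({ v with buf := v.buf ++ r.1, size := v.size + r.2.1 }, r.2.2)

/-- Distribute a merge of two sorted sequences, of `n` records or fewer together, to the buffers of
a list of children. -/
def distribute (P : Params) {σ : Type u} (n : ℕ) :
    List (Stored (Node K σ)) → Pair K → Prog (List (Stored (Node K σ)))
  | [], _ => pure []
  | c :: cs, p => do
      let v ← load c
      let r ← appendTo P n v p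
      let c' ← store r.1
      let cs' ← distribute P n cs r.2
      pure (c' :: cs')

/-- First phase, below and at a given node. A full internal node is emptied: the first `lB` records
of its buffer are sorted, and are merged with the others (which are sorted already) while they are
distributed to the children. Then the children are treated, while the header waits in a work
list. -/
def emptyDown (P : Params) : (h : ℕ) → Stored (Tree K h) → Prog (Stored (Tree K h))
  | 0, c => pure c
  | h + 1, c => do
      let v ← load c
      if v.size < P.l * P.B then do
        release 1
        pure c
      else do
        let s ← selectionSort P P.k ⊥ (v.buf.take P.l)
        let cs ← distribute P v.size v.body (Reader.start s, Reader.start (v.buf.drop P.l))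
        save
        let cs' ← forEach (emptyDown P h) cs
        restore
        store { v with buf := [], size := 0, emptied := true, body := cs' }

/-- Cut a list into `t` consecutive parts whose lengths differ by at most one. -/
def parts {α : Type u} : ℕ → List α → List (List α)
  | 0, _ => []
  | t + 1, xs => xs.take (xs.length / (t + 1)) :: parts t (xs.drop (xs.length / (t + 1)))

/-- Copy a list of cells. The program also returns the key of the last entry. -/
def copy {α : Type u} [Footprint α] (key : α → WithTop K) :
    WithTop K → List (Stored α) → Prog (WithTop K × List (Stored α))
  | u, [] => pure (u, [])
  | _, c :: cs => do
      let a ← load c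
      let c' ← store a
      let r ← copy key (key a) cs
      pure (r.1, c' :: r.2)

/-- Make one node with an empty buffer from each part; the last node is bounded by `u`. -/
def makeNodes {α : Type u} [Footprint α] (key : α → WithTop K) (u : WithTop K) :
    List (List (Stored α)) → Prog (List (Stored (Node K (List (Stored α)))))
  | [] => pure []
  | [g] => do
      let r ← copy key ⊤ g
      occupy 1
      let c ← store (Node.mk u [] 0 false r.2)
      pure [c]
  | g :: gs => do
      let r ← copy key ⊤ g
      occupy 1
      let c ← store (Node.mk r.1 [] 0 false r.2)
      let cs ← makeNodes key u gs
      pure (c :: cs)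

/-- Split a node with the given entries into `⌈number of entries / l⌉` nodes (one node if it has no
more than `l` entries), with as equal shares as possible. -/
def split {α : Type u} [Footprint α] (P : Params) (key : α → WithTop K) (u : WithTop K)
    (items : List (Stored α)) : Prog (List (Stored (Node K (List (Stored α))))) :=
  makeNodes key u (parts ((items.length + P.l - 1) / P.l) items)

/-- The largest record of a sorted block. -/
def lastKey (xs : List K) : WithTop K := (xs.getLast? : Option K)

/-- Second phase, below and at a given node, which is replaced by one or more nodes. The buffer of a
full leaf is sorted and merged with the records of the leaf, and the leaf is split if it has become
too large; so is an internal node after the second phase for its children. Only internal nodes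
emptied in the first phase can have full leaves below. -/
def rebalance (P : Params) : (h : ℕ) → Stored (Tree K h) → Prog (List (Stored (Tree K h)))
  | 0, c => do
      let v ← load c
      if v.size < P.l * P.B then do
        release 1
        pure [c]
      else do
        let a ← selectionSort P P.k ⊥ (v.buf.take P.l)
        let s ← mergeFiles P v.size a (v.buf.drop P.l)
        let d ← mergeFiles P (v.size + P.l * P.B) s v.body
        release 1
        split P lastKey v.upper d
  | h + 1, c => do
      let v ← load c
      if v.emptied then do
        save
        let css ← forEach (rebalance P h) v.body
        restore
        release 1
        split P Node.upper v.upper css.flatten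
      else do
        release 1
        pure [c]

/-- A buffer tree: the partial last block of the root's buffer, which is kept in primary memory,
and the root in secondary memory. The field `buf` of the root holds the full blocks. -/
structure BufferTree (K : Type u) : Type u where
  tail : List K
  height : ℕ
  root : Stored (Tree K height)

/-- The empty buffer tree: a single leaf. -/
def BufferTree.empty (K : Type u) : BufferTree K := ⟨[], 0, ⟨⟨⊤, [], 0, false, []⟩⟩⟩

/-- Put new roots on top of a list of nodes until there is only one node left. The first number
is a bound on the iterations of the loop. -/
def grow (P : Params) : ℕ → (h : ℕ) → List (Stored (Tree K h)) → Prog (BufferTree K)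
  | _, h, [r] => pure ⟨[], h, r⟩
  | n + 1, h, rs => do
      let rs' ← split P Node.upper ⊤ rs
      grow P n (h + 1) rs'
  | 0, _, _ => pure (BufferTree.empty K)

/-- Insertion of a record `x`, which arrives in primary memory. -/
def insert (P : Params) (x : K) (T : BufferTree K) : Prog (BufferTree K) := do
  occupy 1
  let ys := T.tail ++ [x]
  if ys.length < P.B then pure { T with tail := ys }
  else do
    let b ← store ys
    let v ← load T.root
    let r ← store { v with buf := v.buf ++ [b], size := v.size + P.B }
    if v.size + P.B < P.l * P.B then pure ⟨[], T.height, r⟩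
    else do
      let r' ← emptyDown P T.height r
      let rs ← rebalance P T.height r'
      grow P rs.length T.height rs

/-- Insertion of the records of a list, one after the other. -/
def insertAll (P : Params) : List K → BufferTree K → Prog (BufferTree K)
  | [], T => pure T
  | x :: xs, T => do
      let T' ← insert P x T
      insertAll P xs T'

end Insertion

/-! ### The invariants of a buffer tree between insertions -/

section Invariants

variable {K : Type u} [LinearOrder K]

/-- All records in a subtree, in buffers and in leaves. -/
def recordsOf : (h : ℕ) → Tree K h → List K
  | 0, v => contentsOf v.buf ++ contentsOf v.body
  | h + 1, v => contentsOf v.buf ++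
      (List.map (fun c : Stored (Tree K h) => recordsOf h c.contents) v.body).flatten

/-- All records in a buffer tree. -/
def BufferTree.records (T : BufferTree K) : List K :=
  T.tail ++ recordsOf T.height T.root.contents

/-- A dense list of blocks: no block is empty, and all blocks but possibly the last are full. -/
def Dense (B : ℕ) (bs : List (Block K)) : Prop :=
  (∀ b ∈ bs, 0 < b.contents.length ∧ b.contents.length ≤ B) ∧
    ∀ b ∈ bs.dropLast, b.contents.length = B

/-- A node of height `h` is as it has to be in a buffer tree with branching factor `l`: its buffer
is dense and not full and its keys respect its bound; a leaf holds between `lB/4` and `lB` sorted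
records in at most `l` blocks; an internal node has between `l/4` and `l` children, whose subtrees
are separated by the keys. A root may hold fewer records, or have two or more children. -/
def NodeOK (l B : ℕ) : (h : ℕ) → (isRoot : Bool) → Tree K h → Prop
  | 0, isRoot, v =>
      Dense B v.buf ∧ v.size = (contentsOf v.buf).length ∧ v.size < l * B ∧
      (∀ x ∈ recordsOf 0 v, (x : WithTop K) ≤ v.upper) ∧
      Dense B v.body ∧ (contentsOf v.body).Pairwise (· < ·) ∧
      List.length v.body ≤ l ∧ (contentsOf v.body).length ≤ l * B ∧
      (isRoot = false → l * B ≤ 4 * (contentsOf v.body).length)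
  | h + 1, isRoot, v =>
      Dense B v.buf ∧ v.size = (contentsOf v.buf).length ∧ v.size < l * B ∧
      (∀ x ∈ recordsOf (h + 1) v, (x : WithTop K) ≤ v.upper) ∧
      v.emptied = false ∧
      List.length v.body ≤ l ∧ 2 ≤ List.length v.body ∧
      (isRoot = false → l ≤ 4 * List.length v.body) ∧
      (∀ c ∈ (v.body : List (Stored (Tree K h))), NodeOK l B h false c.contents) ∧
      List.Pairwise (fun c d : Stored (Tree K h) =>
        c.contents.upper < d.contents.upper ∧
          ∀ x ∈ recordsOf h d.contents, c.contents.upper < (x : WithTop K)) v.body ∧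
      (∀ c ∈ List.getLast? (v.body : List (Stored (Tree K h))), c.contents.upper = v.upper)

/-- `T` is a buffer tree with branching factor `l` and block size `B`. The buffer of the root is
dense: only its last block, the one in primary memory, is partial. -/
def IsBufferTree (l B : ℕ) (T : BufferTree K) : Prop :=
  NodeOK l B T.height true T.root.contents ∧ T.root.contents.upper = ⊤ ∧
    (∀ b ∈ T.root.contents.buf, b.contents.length = B) ∧ T.tail.length < B

end Invariants

end AEM

/-!
Amortization with a potential. A record in a buffer at height `h` of a tree of height at most `H`
carries credit `13 h + 12 + H`, so that a record inserted with credit `14 H + 16` gives up `13`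
whenever it moves down one level. An internal node that is emptied holds at least `lB` records, and
emptying it causes `O(l)` writes: sorting writes `l` blocks, and every child costs a bounded number
of writes besides the blocks that are passed on. Hence `O(1)` credit per record, at `1/B` writes per
unit, pays for this and leaves `3lB` on the node, which pays for its rebalancing. Sorting the buffer
of a full leaf and rewriting the leaf also takes `O(l)` writes. A new leaf needs `Ω(lB)` new
records, whose remaining credit of `H` each pays for the splits that it causes on the way to the
root. Only the `k` scans of a selection sort read a block more than a bounded number of times, so
`k` times the credit pays for all reads.

Every node but the root has at least `l/4` children or `lB/4` records, so `l ^ h ≤ 4 ^ h n` for a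
tree of height `h` with `n` records, and `8 ≤ l` turns this into `h ≤ 3 log_l n`.
-/

namespace AEM

section Runs

variable {α β : Type u}

/-- The cost semantics of programs: from every meter, `p` returns `a` with at most `r` reads and `w`
writes, changes the occupancy by exactly `d`, and never exceeds the initial occupancy by more than
`pk`. The last two are integers, since a program may start by giving up memory. -/
def Runs (p : Prog α) (a : α) (r w : ℕ) (d pk : ℤ) : Prop :=
  ∀ m : Meter, (p m).1 = a ∧ (p m).2.reads ≤ m.reads + r ∧ (p m).2.writes ≤ m.writes + w ∧
    (p m).2.held = m.held + d ∧ (p m).2.peak ≤ max m.peak (m.held + pk)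

theorem Runs.mono {p : Prog α} {a : α} {r w r' w' : ℕ} {d d' pk pk' : ℤ} (h : Runs p a r w d pk)
    (hr : r ≤ r' := by omega) (hw : w ≤ w' := by omega) (hd : d = d' := by omega)
    (hpk : pk ≤ pk' := by omega) : Runs p a r' w' d' pk' := by
  intro m
  obtain ⟨value, reads, writes, held, peak⟩ := h m
  exact ⟨value, by omega, by omega, by omega, by omega⟩

theorem Runs.pure (a : α) : Runs (pure a) a 0 0 0 0 :=
  fun _ => ⟨rfl, le_rfl, le_rfl, (add_zero _).symm, le_max_left _ _⟩

theorem Runs.bind {p : Prog α} {f : α → Prog β} {a : α} {b : β} {r₁ w₁ r₂ w₂ : ℕ}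
    {d₁ pk₁ d₂ pk₂ : ℤ} (hp : Runs p a r₁ w₁ d₁ pk₁) (hf : Runs (f a) b r₂ w₂ d₂ pk₂) :
    Runs (p >>= f) b (r₁ + r₂) (w₁ + w₂) (d₁ + d₂) (max pk₁ (d₁ + pk₂)) := by
  intro m
  obtain ⟨value, reads₁, writes₁, held₁, peak₁⟩ := hp m
  have bind_eq : (p >>= f) m = f (p m).1 (p m).2 := rfl
  rw [bind_eq, value]
  obtain ⟨value₂, reads₂, writes₂, held₂, peak₂⟩ := hf (p m).2
  exact ⟨value₂, by omega, by omega, by omega, by omega⟩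

theorem Runs.ite_pos {c : Prop} [Decidable c] {p q : Prog α} {a : α} {r w : ℕ} {d pk : ℤ} (hc : c)
    (h : Runs p a r w d pk) : Runs (if c then p else q) a r w d pk := by
  rwa [if_pos hc]

theorem Runs.ite_neg {c : Prop} [Decidable c] {p q : Prog α} {a : α} {r w : ℕ} {d pk : ℤ}
    (hc : ¬c) (h : Runs q a r w d pk) : Runs (if c then p else q) a r w d pk := by
  rwa [if_neg hc]

theorem runs_occupy (n : ℕ) : Runs (occupy.{u} n) ⟨⟩ 0 0 n n :=
  fun _ => ⟨rfl, le_rfl, le_rfl, rfl, le_rfl⟩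

theorem runs_release (n : ℕ) : Runs (release.{u} n) ⟨⟩ 0 0 (-n) 0 :=
  fun _ => ⟨rfl, le_rfl, le_rfl, sub_eq_add_neg _ _, le_max_left _ _⟩

theorem runs_load [Footprint α] (c : Stored α) :
    Runs (load c) c.contents 1 0 (Footprint.words c.contents) (Footprint.words c.contents) :=
  fun _ => ⟨rfl, le_rfl, le_rfl, rfl, le_rfl⟩

theorem runs_store [Footprint α] (a : α) :
    Runs (store a) ⟨a⟩ 0 1 (-(Footprint.words a)) 0 :=
  fun _ => ⟨rfl, le_rfl, le_rfl, sub_eq_add_neg _ _, le_max_left _ _⟩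

theorem runs_load_block {K : Type u} (b : Block K) :
    Runs (load b) b.contents 1 0 b.contents.length b.contents.length :=
  runs_load b

theorem runs_store_block {K : Type u} (xs : List K) :
    Runs (store xs) ⟨xs⟩ 0 1 (-(xs.length : ℤ)) 0 :=
  runs_store xs

theorem runs_load_node {K σ : Type u} (c : Stored (Node K σ)) :
    Runs (load c) c.contents 1 0 1 1 :=
  runs_load c

theorem runs_store_node {K σ : Type u} (v : Node K σ) : Runs (store v) ⟨v⟩ 0 1 (-1) 0 :=
  runs_store v

theorem runs_save : Runs save.{u} ⟨⟩ 0 1 (-1) 0 :=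
  fun _ => ⟨rfl, le_rfl, le_rfl, sub_eq_add_neg _ _, le_max_left _ _⟩

theorem runs_restore : Runs restore.{u} ⟨⟩ 1 0 1 1 :=
  fun _ => ⟨rfl, le_rfl, le_rfl, rfl, le_rfl⟩

theorem runs_forEach {f : α → Prog β} {g : α → β} {r w : α → ℕ} {pk : ℤ} (hpk : 0 ≤ pk)
    (as : List α) (h : ∀ a ∈ as, Runs (f a) (g a) (r a) (w a) 0 pk) :
    Runs (forEach f as) (as.map g) (as.map r).sum (as.map w).sum 0 pk := by
  induction as with
  | nil => exact (Runs.pure _).mono (hpk := hpk)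
  | cons a as ih =>
    rw [List.forall_mem_cons] at h
    simp only [List.map_cons, List.sum_cons]
    exact Runs.mono (h.1.bind ((ih h.2).bind (Runs.pure _)))

end Runs

section Contents

variable {K : Type u}

@[simp] theorem contentsOf_nil : contentsOf ([] : List (Block K)) = [] := rfl

@[simp] theorem contentsOf_cons (b : Block K) (bs : List (Block K)) :
    contentsOf (b :: bs) = b.contents ++ contentsOf bs := rfl

@[simp] theorem contentsOf_append (as bs : List (Block K)) :
    contentsOf (as ++ bs) = contentsOf as ++ contentsOf bs := by
  simp [contentsOf]

theorem contentsOf_flatten (gs : List (List (Block K))) :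
    contentsOf gs.flatten = (gs.map contentsOf).flatten := by
  induction gs with
  | nil => rfl
  | cons g gs ih => simp [ih]

theorem mem_contentsOf {bs : List (Block K)} {x : K} :
    x ∈ contentsOf bs ↔ ∃ b ∈ bs, x ∈ b.contents := by
  simp [contentsOf]

theorem length_contentsOf {B : ℕ} {bs : List (Block K)} (h : ∀ b ∈ bs, b.contents.length = B) :
    (contentsOf bs).length = bs.length * B := by
  induction bs with
  | nil => simp
  | cons b bs ih =>
    rw [List.forall_mem_cons] at h
    rw [contentsOf_cons, List.length_append, ih h.2, h.1, List.length_cons, Nat.succ_mul, add_comm]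

theorem runs_writeOut (P : Params) (hB : 0 < P.B) (n : ℕ) (ys : List K)
    (h : ys.length = n * P.B) :
    ∃ out, Runs (writeOut P n ys) out 0 n (-(ys.length : ℤ)) 0 ∧
      (∀ b ∈ out, b.contents.length = P.B) ∧ contentsOf out = ys := by
  induction n generalizing ys with
  | zero =>
    obtain rfl : ys = [] := List.length_eq_zero_iff.1 (by simpa using h)
    exact ⟨[], Runs.pure _, by simp, rfl⟩
  | succ n ih =>
    rw [Nat.succ_mul] at h
    have take_length : (ys.take P.B).length = P.B := by rw [List.length_take]; omega
    have drop_length : (ys.drop P.B).length = n * P.B := by rw [List.length_drop]; omega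
    have ys_ne : ys ≠ [] := by rintro rfl; rw [List.length_nil] at h; omega
    obtain ⟨out, runs, full, contents⟩ := ih (ys.drop P.B) drop_length
    refine ⟨⟨ys.take P.B⟩ :: out, ?_, List.forall_mem_cons.2 ⟨take_length, full⟩, ?_⟩
    · simp only [writeOut, if_neg ys_ne]
      exact Runs.mono ((runs_store_block _).bind (runs.bind (Runs.pure _)))
    · rw [contentsOf_cons, contents, List.take_append_drop]

end Contents

/-! ### Selection sort -/

section Smallest

variable {K : Type u} [LinearOrder K]

theorem take_orderedInsert (x : K) (m : ℕ) (ys : List K) :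
    (ys.orderedInsert (· ≤ ·) x).take m = ((ys.take m).orderedInsert (· ≤ ·) x).take m := by
  induction ys generalizing m with
  | nil => simp
  | cons y ys ih =>
    cases m with
    | zero => simp
    | succ m =>
      simp only [List.orderedInsert_cons, List.take_succ_cons]
      split_ifs with h
      · cases m <;> simp [List.take_take]
      · simp [ih m]

theorem take_foldr_orderedInsert (m : ℕ) (xs ys : List K) :
    (xs.foldr (List.orderedInsert (· ≤ ·)) ys).take m =
      (xs.foldr (List.orderedInsert (· ≤ ·)) (ys.take m)).take m := by
  induction xs with
  | nil => simp
  | cons x xs ih => rw [List.foldr_cons, List.foldr_cons, take_orderedInsert, ih,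
      ← take_orderedInsert]

theorem insertionSort_append (xs ys : List K) : (xs ++ ys).insertionSort (· ≤ ·) =
    xs.foldr (List.orderedInsert (· ≤ ·)) (ys.insertionSort (· ≤ ·)) := by
  simp [List.insertionSort, List.foldr_append]

theorem insertionSort_congr {xs ys : List K} (h : xs.Perm ys) :
    xs.insertionSort (· ≤ ·) = ys.insertionSort (· ≤ ·) :=
  ((List.perm_insertionSort _ xs).trans (h.trans
    (List.perm_insertionSort _ ys).symm)).eq_of_sortedLE
    List.sortedLE_insertionSort List.sortedLE_insertionSort

theorem insertionSort_filter (p : K → Bool) (xs : List K) :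
    (xs.filter p).insertionSort (· ≤ ·) = (xs.insertionSort (· ≤ ·)).filter p := by
  rw [insertionSort_congr ((List.perm_insertionSort (· ≤ ·) xs).symm.filter p)]
  exact ((List.pairwise_insertionSort _ _).filter p).insertionSort_eq

theorem pairwise_lt_insertionSort {xs : List K} (h : xs.Nodup) :
    (xs.insertionSort (· ≤ ·)).Pairwise (· < ·) :=
  ((List.pairwise_insertionSort (· ≤ ·) xs).and
    ((List.perm_insertionSort _ xs).nodup_iff.2 h)).imp fun h => lt_of_le_of_ne h.1 h.2

theorem length_smallest (m : ℕ) (xs : List K) : (smallest m xs).length = min m xs.length := by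
  simp [smallest]

theorem smallest_smallest_append (m : ℕ) (xs ys : List K) :
    smallest m (smallest m xs ++ ys) = smallest m (xs ++ ys) := by
  have smallest_comm (zs : List K) : smallest m (zs ++ ys) = smallest m (ys ++ zs) := by
    rw [smallest, smallest, insertionSort_congr List.perm_append_comm]
  have sorted : (smallest m xs).insertionSort (· ≤ ·) = smallest m xs :=
    (List.pairwise_insertionSort _ _).take.insertionSort_eq
  rw [smallest_comm, smallest_comm, smallest, insertionSort_append, sorted, smallest,
    ← take_foldr_orderedInsert, ← insertionSort_append, smallest]

end Smallest

section SelectionSort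

variable {K : Type u}

/-- The last entry of a list, or `⊥`. -/
def lastBot (xs : List K) : WithBot K := (xs.getLast? : Option K)

theorem lastBot_append_singleton (xs : List K) (x : K) : lastBot (xs ++ [x]) = (x : WithBot K) := by
  rw [lastBot, List.getLast?_concat]
  rfl

variable [LinearOrder K]

/-- The records that a phase of selection sort considers: those above the last record `u` that has
been output. -/
def above (u : WithBot K) (xs : List K) : List K :=
  xs.filter fun x : K => u < (x : WithBot K)

theorem above_append (u : WithBot K) (xs ys : List K) :
    above u (xs ++ ys) = above u xs ++ above u ys :=
  List.filter_append ..

theorem above_bot (xs : List K) : above ⊥ xs = xs :=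
  List.filter_eq_self.2 fun x _ => by simp

theorem above_above {u v : WithBot K} (h : u ≤ v) (xs : List K) :
    above v (above u xs) = above v xs := by
  rw [above, above, List.filter_filter]
  refine List.filter_congr fun x _ => ?_
  have : v < (x : WithBot K) → u < (x : WithBot K) := h.trans_lt
  simpa using this

theorem above_lastBot_append {xs ys : List K} (hxs : xs ≠ []) (h : (xs ++ ys).Pairwise (· < ·)) :
    above (lastBot xs) (xs ++ ys) = ys := by
  obtain ⟨xs, x, rfl⟩ := (List.eq_nil_or_concat' xs).resolve_left hxs
  obtain ⟨sorted, -, separated⟩ := List.pairwise_append.1 h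
  obtain ⟨-, -, last_max⟩ := List.pairwise_append.1 sorted
  have above_eq_nil : above (x : WithBot K) (xs ++ [x]) = [] := by
    refine List.filter_eq_nil_iff.2 fun y hy => ?_
    rcases List.mem_append.1 hy with hy | hy
    · simpa using (last_max y hy x (List.mem_singleton_self x)).le
    · simp [List.mem_singleton.1 hy]
  rw [lastBot_append_singleton, above_append, above_eq_nil, List.nil_append]
  exact List.filter_eq_self.2 fun y hy => by simpa using separated x (by simp) y hy

theorem insertionSort_above_lastBot_smallest {u : WithBot K} {xs : List K} (hxs : xs.Nodup) {m : ℕ}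
    (hm : 0 < m) (hne : above u xs ≠ []) :
    (above (lastBot (smallest m (above u xs))) xs).insertionSort (· ≤ ·) =
      ((above u xs).insertionSort (· ≤ ·)).drop m := by
  set sorted := (above u xs).insertionSort (· ≤ ·)
  have sorted_lt : sorted.Pairwise (· < ·) := pairwise_lt_insertionSort (hxs.filter _)
  have phase_ne : sorted.take m ≠ [] := List.ne_nil_of_length_pos <| by
    have := List.length_pos_of_ne_nil hne
    rw [List.length_take, List.length_insertionSort]
    omega
  have le_last : u ≤ lastBot (sorted.take m) := by
    obtain ⟨ys, y, phase_eq⟩ := (List.eq_nil_or_concat' _).resolve_left phase_ne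
    have mem : y ∈ above u xs := (List.mem_insertionSort _).1 <|
      List.mem_of_mem_take (phase_eq ▸ List.mem_append_right ys (List.mem_singleton_self y))
    rw [phase_eq, lastBot_append_singleton]
    exact (of_decide_eq_true (List.mem_filter.1 mem).2).le
  calc (above (lastBot (sorted.take m)) xs).insertionSort (· ≤ ·)
      = above (lastBot (sorted.take m)) sorted := by
        rw [← above_above le_last, above, insertionSort_filter]; rfl
    _ = sorted.drop m := by
        simpa only [List.take_append_drop] using
          above_lastBot_append phase_ne (ys := sorted.drop m) (by rwa [List.take_append_drop])

theorem runs_scan (P : Params) (u : WithBot K) (bs : List (Block K)) (zs : List K)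
    (hB : ∀ b ∈ bs, b.contents.length ≤ P.B) :
    Runs (scan P u bs (smallest P.M zs)) (smallest P.M (zs ++ above u (contentsOf bs))) bs.length 0
      ((smallest P.M (zs ++ above u (contentsOf bs))).length - (smallest P.M zs).length)
      (P.M + P.B - (smallest P.M zs).length) := by
  induction bs generalizing zs with
  | nil =>
    have := length_smallest P.M zs
    rw [contentsOf_nil, above, List.filter_nil, List.append_nil]
    exact (Runs.pure _).mono
  | cons b bs ih =>
    rw [List.forall_mem_cons] at hB
    have retained : smallest P.M (smallest P.M zs ++ above u b.contents) =
        smallest P.M (zs ++ above u b.contents) := smallest_smallest_append ..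
    have tail := ih (zs ++ above u b.contents) hB.2
    rw [List.append_assoc, ← above_append, ← contentsOf_cons, ← retained] at tail
    have : (above u b.contents).length ≤ b.contents.length := List.length_filter_le ..
    have := length_smallest P.M zs
    have := length_smallest P.M (smallest P.M zs ++ above u b.contents)
    rw [List.length_append] at this
    rw [List.length_cons]
    exact Runs.mono ((runs_load_block b).bind ((runs_release ((smallest P.M zs).length +
      b.contents.length - (smallest P.M (smallest P.M zs ++ above u b.contents)).length)).bind
      tail))

theorem runs_selectionSort (P : Params) (hB : 0 < P.B) (hM : 0 < P.M) (hBM : P.B ∣ P.M)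
    (bs : List (Block K)) (hbs : ∀ b ∈ bs, b.contents.length ≤ P.B) (hnd : (contentsOf bs).Nodup)
    (r : ℕ) (u : WithBot K) (h : (above u (contentsOf bs)).length = r * P.M) :
    ∃ out, Runs (selectionSort P r u bs) out (r * bs.length) (r * (P.M / P.B)) 0 (P.M + P.B) ∧
      (∀ b ∈ out, b.contents.length = P.B) ∧
      contentsOf out = (above u (contentsOf bs)).insertionSort (· ≤ ·) := by
  induction r generalizing u with
  | zero =>
    have empty : above u (contentsOf bs) = [] := List.length_eq_zero_iff.1 (h.trans (zero_mul _))
    exact ⟨[], (Runs.pure _).mono, by simp, by rw [empty]; rfl⟩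
  | succ r ih =>
    rw [Nat.succ_mul] at h
    set phase := smallest P.M (above u (contentsOf bs)) with phase_def
    have phase_length : phase.length = P.M := by rw [phase_def, length_smallest]; omega
    have remaining : (above (lastBot phase) (contentsOf bs)).insertionSort (· ≤ ·) =
        ((above u (contentsOf bs)).insertionSort (· ≤ ·)).drop P.M :=
      insertionSort_above_lastBot_smallest hnd hM (List.ne_nil_of_length_pos (by omega))
    have remaining_length : (above (lastBot phase) (contentsOf bs)).length = r * P.M := by
      rw [← List.length_insertionSort (· ≤ ·), remaining, List.length_drop,
        List.length_insertionSort]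
      omega
    have scanned : Runs (scan P u bs []) phase bs.length 0 phase.length (P.M + P.B) := by
      have : smallest P.M ([] : List K) = [] := List.take_nil
      simpa only [this, List.nil_append, List.length_nil, Nat.cast_zero, sub_zero] using
        runs_scan P u bs [] hbs
    obtain ⟨out, out_runs, out_full, out_contents⟩ := runs_writeOut P hB (P.M / P.B) phase
      (by rw [phase_length, Nat.div_mul_cancel hBM])
    obtain ⟨rest, rest_runs, rest_full, rest_contents⟩ := ih (lastBot phase) remaining_length
    refine ⟨out ++ rest, ?_, List.forall_mem_append.2 ⟨out_full, rest_full⟩, ?_⟩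
    · rw [Nat.succ_mul, Nat.succ_mul]
      exact Runs.mono (scanned.bind (out_runs.bind (rest_runs.bind (Runs.pure _))))
    · rw [contentsOf_append, out_contents, rest_contents, remaining]
      exact List.take_append_drop ..

end SelectionSort

/-! ### Sequences of blocks -/

section Dense

variable {K : Type u} {B : ℕ} {as bs : List (Block K)}

theorem dense_nil (B : ℕ) : Dense B ([] : List (Block K)) := by simp [Dense]

theorem Dense.ne_nil_of_mem (h : Dense B bs) {b : Block K} (hb : b ∈ bs) : b.contents ≠ [] :=
  List.length_pos_iff.1 (h.1 b hb).1

theorem dense_cons {b : Block K} : Dense B (b :: bs) ↔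
    (0 < b.contents.length ∧ b.contents.length ≤ B) ∧ (bs = [] ∨ b.contents.length = B) ∧
      Dense B bs := by
  cases bs with
  | nil => simp [Dense]
  | cons c bs => simp [Dense]; tauto

theorem Dense.of_append_left (h : Dense B (as ++ bs)) : Dense B as := by
  induction as with
  | nil => exact dense_nil B
  | cons a as ih =>
    obtain ⟨size, full, tail⟩ := dense_cons.1 h
    exact dense_cons.2 ⟨size, full.imp_left fun h => (List.append_eq_nil_iff.1 h).1, ih tail⟩

theorem Dense.of_append_right (h : Dense B (as ++ bs)) : Dense B bs := by
  induction as with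
  | nil => exact h
  | cons a as ih => exact ih (dense_cons.1 h).2.2

theorem Dense.append (hB : 0 < B) (has : ∀ a ∈ as, a.contents.length = B) (hbs : Dense B bs) :
    Dense B (as ++ bs) := by
  induction as with
  | nil => exact hbs
  | cons a as ih =>
    rw [List.forall_mem_cons] at has
    exact dense_cons.2 ⟨by omega, Or.inr has.1, ih has.2⟩

theorem Dense.eq_nil_of_contentsOf_eq_nil (h : Dense B bs) (hbs : contentsOf bs = []) :
    bs = [] := by
  cases bs with
  | nil => rfl
  | cons b bs =>
    have := (dense_cons.1 h).1.1
    rw [contentsOf_cons, List.append_eq_nil_iff] at hbs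
    simp [hbs.1] at this

theorem Dense.length_mul_lt (h : Dense B bs) (hbs : bs ≠ []) :
    bs.length * B < (contentsOf bs).length + B := by
  induction bs with
  | nil => contradiction
  | cons b bs ih =>
    obtain ⟨size, full, tail⟩ := dense_cons.1 h
    rw [contentsOf_cons, List.length_append, List.length_cons, Nat.succ_mul]
    by_cases hbs : bs = []
    · subst hbs; simpa using size.1
    · have := ih tail hbs
      have := full.resolve_left hbs
      omega

theorem Dense.length_mul_le (h : Dense B bs) : bs.length * B ≤ (contentsOf bs).length + B := by
  by_cases hbs : bs = []
  · simp [hbs]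
  · exact (h.length_mul_lt hbs).le

theorem Dense.length_contentsOf_le (h : Dense B bs) : (contentsOf bs).length ≤ bs.length * B := by
  induction bs with
  | nil => simp
  | cons b bs ih =>
    obtain ⟨size, -, tail⟩ := dense_cons.1 h
    have := ih tail
    rw [contentsOf_cons, List.length_append, List.length_cons, Nat.succ_mul]
    omega

theorem Dense.length_take_and_full (h : Dense B bs) (hB : 0 < B) {n : ℕ}
    (hn : n * B ≤ (contentsOf bs).length) :
    (bs.take n).length = n ∧ ∀ b ∈ bs.take n, b.contents.length = B := by
  induction n generalizing bs with
  | zero => simp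
  | succ n ih =>
    rw [Nat.succ_mul] at hn
    cases bs with
    | nil => simp only [contentsOf_nil, List.length_nil] at hn; omega
    | cons b bs =>
      obtain ⟨size, full, tail⟩ := dense_cons.1 h
      rw [contentsOf_cons, List.length_append] at hn
      have b_full : b.contents.length = B := by
        rcases full with rfl | full
        · simp only [contentsOf_nil, List.length_nil] at hn; omega
        · exact full
      obtain ⟨length, rest_full⟩ := ih tail (by omega)
      rw [List.take_succ_cons]
      exact ⟨by simp only [List.length_cons, length],
        List.forall_mem_cons.2 ⟨b_full, rest_full⟩⟩

end Dense

namespace Reader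

variable {K : Type u}

/-- The records that a reader has yet to deliver. -/
def toList (s : Reader K) : List K := s.cur ++ contentsOf s.rest

/-- All blocks of the reader are of size at most `B`, and those to come are nonempty. -/
def Ok (B : ℕ) (s : Reader K) : Prop :=
  s.cur.length ≤ B ∧ ∀ b ∈ s.rest, 0 < b.contents.length ∧ b.contents.length ≤ B

theorem ok_start {B : ℕ} {bs : List (Block K)} (h : Dense B bs) : (start bs).Ok B :=
  ⟨Nat.zero_le B, h.1⟩

/-- The result of `Reader.refill`. -/
def refilled (s : Reader K) : Reader K :=
  match s.cur, s.rest with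
  | [], b :: bs => ⟨b.contents, bs⟩
  | _, _ => s

theorem toList_refilled (s : Reader K) : s.refilled.toList = s.toList := by
  rcases s with ⟨_ | ⟨x, xs⟩, _ | ⟨b, bs⟩⟩ <;> rfl

theorem length_rest_refilled_le (s : Reader K) : s.refilled.rest.length ≤ s.rest.length := by
  rcases s with ⟨_ | ⟨x, xs⟩, _ | _⟩ <;> simp [refilled]

theorem Ok.refilled {B : ℕ} {s : Reader K} (h : s.Ok B) : s.refilled.Ok B := by
  rcases s with ⟨_ | ⟨x, xs⟩, _ | _⟩
  case nil.cons =>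
    obtain ⟨⟨-, hb⟩, hbs⟩ := List.forall_mem_cons.1 h.2
    exact ⟨hb, hbs⟩
  all_goals exact h

theorem Ok.toList_refilled_eq_nil {B : ℕ} {s : Reader K} (h : s.Ok B)
    (hs : s.refilled.cur = []) : s.refilled.toList = [] := by
  rcases s with ⟨_ | ⟨x, xs⟩, _ | ⟨b, bs⟩⟩
  case nil.cons =>
    have := (h.2 b List.mem_cons_self).1
    exact absurd (List.length_eq_zero_iff.2 hs) this.ne'
  case nil.nil => rfl
  all_goals cases hs

theorem Ok.tail {B : ℕ} {x : K} {xs : List K} {bs : List (Block K)}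
    (h : Ok B ⟨x :: xs, bs⟩) : Ok B ⟨xs, bs⟩ :=
  ⟨(Nat.le_succ _).trans h.1, h.2⟩

end Reader

theorem runs_refill {K : Type u} {B : ℕ} {s : Reader K} (h : s.Ok B) :
    Runs s.refill s.refilled (s.rest.length - s.refilled.rest.length) 0
      ((s.refilled.cur.length : ℤ) - s.cur.length) (B - s.cur.length) := by
  rcases s with ⟨_ | ⟨x, xs⟩, _ | ⟨b, bs⟩⟩
  case nil.cons =>
    have := (h.2 b List.mem_cons_self).2
    simp only [Reader.refilled, List.length_cons, List.length_nil]
    exact Runs.mono ((runs_load_block b).bind (Runs.pure _))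
  all_goals
    have := h.1
    simp only [Reader.refilled] at this ⊢
    exact Runs.mono (Runs.pure _)

/-! ### Merging -/

namespace Pair

variable {K : Type u}

/-- The number of blocks yet to be read. -/
def blocks (p : Pair K) : ℕ := p.1.rest.length + p.2.rest.length

/-- The number of records in primary memory. -/
def held (p : Pair K) : ℕ := p.1.cur.length + p.2.cur.length

/-- Both readers satisfy `Reader.Ok`. -/
def Ok (B : ℕ) (p : Pair K) : Prop := p.1.Ok B ∧ p.2.Ok B

/-- The result of refilling both readers. -/
def refilled (p : Pair K) : Pair K := (p.1.refilled, p.2.refilled)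

theorem Ok.held_le {B : ℕ} {p : Pair K} (h : p.Ok B) : p.held ≤ 2 * B := by
  have := h.1.1
  have := h.2.1
  rw [held]
  omega

variable [LinearOrder K]

/-- The outcome of merging what two readers have yet to deliver. -/
def merged (p : Pair K) : List K :=
  List.merge p.1.toList p.2.toList fun a b => decide (a ≤ b)

/-- The records at the head of the merge that are at most `u`. -/
def upTo (u : WithTop K) (p : Pair K) : List K :=
  p.merged.takeWhile fun z : K => decide ((z : WithTop K) ≤ u)

/-- The merge `p` may turn into `p'` by giving out the records `ys`, all readers having blocks of
size at most `B`. -/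
structure Delivers (B : ℕ) (p : Pair K) (ys : List K) (p' : Pair K) : Prop where
  ok : p'.Ok B
  blocks_le : p'.blocks ≤ p.blocks
  merged_eq : p.merged = ys ++ p'.merged

theorem Ok.delivers_nil {B : ℕ} {p : Pair K} (h : p.Ok B) : p.Delivers B [] p :=
  ⟨h, le_rfl, rfl⟩

theorem Delivers.trans {B : ℕ} {p p' p'' : Pair K} {ys zs : List K} (h : p.Delivers B ys p')
    (h' : p'.Delivers B zs p'') : p.Delivers B (ys ++ zs) p'' :=
  ⟨h'.ok, h'.blocks_le.trans h.blocks_le, by rw [h.merged_eq, h'.merged_eq, List.append_assoc]⟩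

theorem held_eq_zero {p : Pair K} (h : p.merged = []) : p.held = 0 := by
  have := congrArg List.length h
  simp [merged, Reader.toList, List.length_merge] at this
  simp [held, this]

theorem Delivers.upTo_eq_drop {B : ℕ} {u : WithTop K} {p p' : Pair K} {n : ℕ}
    (h : p.Delivers B ((p.upTo u).take n) p') : p'.upTo u = (p.upTo u).drop n := by
  have delivered_le : ∀ z ∈ (p.upTo u).take n, decide ((z : WithTop K) ≤ u) = true := fun z hz =>
    List.mem_takeWhile_imp (p := fun z : K => decide ((z : WithTop K) ≤ u))
      (List.mem_of_mem_take hz)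
  have upTo_eq : p.upTo u = (p.upTo u).take n ++ p'.upTo u := by
    conv_lhs => rw [upTo, h.merged_eq]
    exact List.takeWhile_append_of_pos delivered_le
  exact (List.append_cancel_left ((List.take_append_drop n (p.upTo u)).trans upTo_eq)).symm

theorem Ok.refilled_delivers {B : ℕ} {p : Pair K} (h : p.Ok B) : p.Delivers B [] p.refilled where
  ok := ⟨h.1.refilled, h.2.refilled⟩
  blocks_le := Nat.add_le_add p.1.length_rest_refilled_le p.2.length_rest_refilled_le
  merged_eq := by
    rw [merged, merged, refilled, Reader.toList_refilled, Reader.toList_refilled, List.nil_append]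

/-- Take the smaller of the two next records out of the blocks in primary memory, if any. -/
def pop (p : Pair K) : Option (K × Pair K) :=
  match p.1.cur, p.2.cur with
  | [], [] => none
  | x :: xs, [] => some (x, (⟨xs, p.1.rest⟩, p.2))
  | [], y :: ys => some (y, (p.1, ⟨ys, p.2.rest⟩))
  | x :: xs, y :: ys =>
      if x ≤ y then some (x, (⟨xs, p.1.rest⟩, p.2)) else some (y, (p.1, ⟨ys, p.2.rest⟩))

/-- The part of `pull` after the refills. -/
def pick (u : WithTop K) (p : Pair K) : Option K × Pair K :=
  match p.pop with
  | none => (none, p)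
  | some (x, q) => if (x : WithTop K) ≤ u then (some x, q) else (none, p)

theorem pull_eq (u : WithTop K) (p : Pair K) :
    pull u p = p.1.refill >>= fun s => p.2.refill >>= fun t => pure (pick u (s, t)) := by
  rw [pull]
  congr! with s t
  rcases s with ⟨_ | ⟨x, xs⟩, as⟩ <;> rcases t with ⟨_ | ⟨y, ys⟩, bs⟩ <;>
    dsimp only [pick, pop] <;> split_ifs <;> simp only [*, if_true, if_false]

/-- Both readers have their next record in primary memory, unless they have delivered everything. -/
structure Ready (B : ℕ) (p : Pair K) : Prop where
  ok : p.Ok B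
  left : p.1.cur = [] → p.1.toList = []
  right : p.2.cur = [] → p.2.toList = []

theorem Ok.ready_refilled {B : ℕ} {p : Pair K} (h : p.Ok B) : p.refilled.Ready B :=
  ⟨h.refilled_delivers.ok, h.1.toList_refilled_eq_nil, h.2.toList_refilled_eq_nil⟩

theorem Ready.merged_eq_nil {B : ℕ} {p : Pair K} (h : p.Ready B) (hp : p.pop = none) :
    p.merged = [] := by
  unfold pop at hp
  split at hp
  case h_1 left_nil right_nil => simp [merged, h.left left_nil, h.right right_nil]
  case h_4 => split_ifs at hp
  all_goals cases hp

theorem Ready.delivers_pop {B : ℕ} {p q : Pair K} {x : K} (h : p.Ready B)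
    (hp : p.pop = some (x, q)) : p.Delivers B [x] q := by
  obtain ⟨⟨left_ok, right_ok⟩, left, right⟩ := h
  rcases p with ⟨⟨_ | ⟨a, as⟩, ss⟩, ⟨_ | ⟨b, bs⟩, ts⟩⟩
  case nil.nil => cases hp
  case nil.cons =>
    cases hp
    exact ⟨⟨left_ok, right_ok.tail⟩, le_rfl, by simp [merged, left rfl]; rfl⟩
  case cons.nil =>
    cases hp
    exact ⟨⟨left_ok.tail, right_ok⟩, le_rfl, by simp [merged, right rfl]; rfl⟩
  case cons.cons =>
    dsimp only [pop] at hp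
    split_ifs at hp with hab <;> cases hp
    · exact ⟨⟨left_ok.tail, right_ok⟩, le_rfl, by simp [merged, Reader.toList, hab]⟩
    · exact ⟨⟨left_ok, right_ok.tail⟩, le_rfl, by simp [merged, Reader.toList, hab]⟩

theorem blocks_and_held_pop {p q : Pair K} {x : K} (hp : p.pop = some (x, q)) :
    q.blocks = p.blocks ∧ q.held + 1 = p.held := by
  rcases p with ⟨⟨_ | ⟨a, as⟩, ss⟩, ⟨_ | ⟨b, bs⟩, ts⟩⟩ <;> dsimp only [pop] at hp <;>
    try split_ifs at hp
  all_goals cases hp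
  all_goals exact ⟨rfl, by simp +arith [held]⟩

theorem Ready.pick {B : ℕ} {p : Pair K} (h : p.Ready B) (u : WithTop K) :
    ∃ q, p.pick u = ((p.upTo u).head?, q) ∧ p.Delivers B ((p.upTo u).take 1) q ∧
      q.blocks = p.blocks ∧ q.held + ((p.upTo u).take 1).length = p.held := by
  rcases hp : p.pop with _ | ⟨x, q⟩
  · have upTo_nil : p.upTo u = [] := by rw [upTo, h.merged_eq_nil hp, List.takeWhile_nil]
    exact ⟨p, by simp [Pair.pick, hp, upTo_nil], by simpa [upTo_nil] using h.ok.delivers_nil, rfl,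
      by simp [upTo_nil]⟩
  have delivers := h.delivers_pop hp
  by_cases hx : (x : WithTop K) ≤ u
  · have upTo_cons : p.upTo u = x :: q.upTo u := by simp [upTo, delivers.merged_eq, hx]
    obtain ⟨blocks_eq, held_eq⟩ := blocks_and_held_pop hp
    exact ⟨q, by simp [Pair.pick, hp, hx, upTo_cons], by simpa [upTo_cons] using delivers,
      blocks_eq, by simpa [upTo_cons] using held_eq⟩
  · have upTo_nil : p.upTo u = [] := by simp [upTo, delivers.merged_eq, hx]
    exact ⟨p, by simp [Pair.pick, hp, hx, upTo_nil],
      by simpa [upTo_nil] using h.ok.delivers_nil, rfl, by simp [upTo_nil]⟩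

end Pair

section Merge

variable {K : Type u} [LinearOrder K]

theorem runs_pull {B : ℕ} (u : WithTop K) {p : Pair K} (h : p.Ok B) :
    ∃ q, p.Delivers B ((p.upTo u).take 1) q ∧
      Runs (pull u p) ((p.upTo u).head?, q) (p.blocks - q.blocks) 0
        ((q.held : ℤ) + ((p.upTo u).take 1).length - p.held) (2 * B - p.held) := by
  have refill := h.refilled_delivers
  obtain ⟨q, pick_eq, delivers, blocks_eq, held_eq⟩ := h.ready_refilled.pick u
  have upTo_eq : p.refilled.upTo u = p.upTo u := by rw [Pair.upTo, Pair.upTo, refill.merged_eq]; rfl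
  rw [upTo_eq] at pick_eq delivers held_eq
  refine ⟨q, refill.trans delivers, ?_⟩
  rw [Pair.pull_eq]
  have : p.2.cur.length ≤ B := h.2.1
  have : p.1.refilled.cur.length ≤ B := h.1.refilled.1
  have : p.2.refilled.cur.length ≤ B := h.2.refilled.1
  have := p.1.length_rest_refilled_le
  have := p.2.length_rest_refilled_le
  rw [← pick_eq]
  simp only [Pair.blocks, Pair.held, Pair.refilled] at blocks_eq held_eq ⊢
  exact Runs.mono ((runs_refill h.1).bind ((runs_refill h.2).bind (Runs.pure _)))

theorem runs_pullMany {B : ℕ} (u : WithTop K) (n : ℕ) {p : Pair K} (h : p.Ok B) :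
    ∃ q, p.Delivers B ((p.upTo u).take n) q ∧
      Runs (pullMany u n p) ((p.upTo u).take n, q) (p.blocks - q.blocks) 0
        ((q.held : ℤ) + ((p.upTo u).take n).length - p.held) (2 * B + n - p.held) := by
  have := h.held_le
  induction n generalizing p with
  | zero =>
    simp only [List.take_zero, List.length_nil]
    exact ⟨p, h.delivers_nil, Runs.mono (Runs.pure _)⟩
  | succ n ih =>
    obtain ⟨q, first, first_runs⟩ := runs_pull u h
    have := first.ok.held_le
    have upTo_eq := first.upTo_eq_drop
    rcases hp : p.upTo u with _ | ⟨x, xs⟩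
    · rw [hp] at first first_runs
      simp only [List.take_nil, List.length_nil] at first first_runs ⊢
      exact ⟨q, first, Runs.mono (first_runs.bind (Runs.pure _))⟩
    · obtain ⟨q', rest, rest_runs⟩ := ih first.ok this
      rw [hp] at first first_runs upTo_eq
      have : q'.held ≤ 2 * B := rest.ok.held_le
      have : (xs.take n).length ≤ n := List.length_take_le n xs
      rw [upTo_eq] at rest rest_runs
      have := rest.blocks_le
      have := first.blocks_le
      simp only [List.take_succ_cons, List.length_cons, List.take_zero, List.length_nil,
        List.drop_succ_cons, List.drop_zero] at first first_runs rest rest_runs ⊢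
      exact ⟨q', first.trans rest, Runs.mono (first_runs.bind (rest_runs.bind (Runs.pure _)))⟩

theorem runs_emit (P : Params) (hB : 0 < P.B) (u : WithTop K) (n : ℕ) {p : Pair K} (h : p.Ok P.B)
    (hn : (p.upTo u).length ≤ n) :
    ∃ bs q, p.Delivers P.B (p.upTo u) q ∧ Dense P.B bs ∧ contentsOf bs = p.upTo u ∧
      Runs (emit P u n p) (bs, (p.upTo u).length, q) (p.blocks - q.blocks) bs.length
        ((q.held : ℤ) - p.held) (3 * P.B - p.held) := by
  have := h.held_le
  induction n generalizing p with
  | zero =>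
    have upTo_nil : p.upTo u = [] := List.length_eq_zero_iff.1 (Nat.le_zero.1 hn)
    rw [upTo_nil]
    exact ⟨[], p, h.delivers_nil, dense_nil _, rfl, Runs.mono (Runs.pure _)⟩
  | succ n ih =>
    obtain ⟨q, first, first_runs⟩ := runs_pullMany u P.B h
    have held_q := first.ok.held_le
    have upTo_eq := first.upTo_eq_drop
    have upTo_split := List.take_append_drop P.B (p.upTo u)
    set block := (p.upTo u).take P.B
    by_cases block_nil : block = []
    · have upTo_nil : p.upTo u = [] := (List.take_eq_nil_iff.1 block_nil).resolve_left hB.ne'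
      simp only [upTo_nil, block_nil, List.length_nil] at first first_runs ⊢
      exact ⟨[], q, first, dense_nil _, rfl,
        Runs.mono (first_runs.bind (Runs.ite_pos rfl (Runs.pure _)))⟩
    have block_pos : 0 < block.length := List.length_pos_iff.2 block_nil
    have block_le : block.length ≤ P.B := List.length_take_le ..
    have length_eq := congrArg List.length upTo_split
    rw [List.length_append] at length_eq
    obtain ⟨bs, q', rest, dense, contents, rest_runs⟩ := ih first.ok (by rw [upTo_eq]; omega) held_q
    rw [upTo_eq] at rest contents rest_runs
    have := rest.ok.held_le
    have := rest.blocks_le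
    have := first.blocks_le
    refine ⟨⟨block⟩ :: bs, q', upTo_split ▸ first.trans rest, ?_, ?_, ?_⟩
    · refine dense_cons.2 ⟨⟨block_pos, block_le⟩, ?_, dense⟩
      rcases le_or_gt (p.upTo u).length P.B with short | long
      · exact Or.inl (dense.eq_nil_of_contentsOf_eq_nil
          (by rw [contents, List.drop_of_length_le short]))
      · exact Or.inr (List.length_take_of_le long.le)
    · rw [contentsOf_cons, contents, upTo_split]
    · rw [← length_eq, List.length_cons]
      exact Runs.mono (first_runs.bind (Runs.ite_neg block_nil
        ((runs_store_block block).bind (rest_runs.bind (Runs.pure _)))))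

end Merge

/-! ### Distribution -/

section Distribution

variable {K : Type u}

/-- `v.Receives B ys v'`: the node `v'` is `v` with the records `ys` appended to its buffer. -/
inductive Node.Receives {σ : Type u} (B : ℕ) (v : Node K σ) (ys : List K) : Node K σ → Prop
  | mk (buf : List (Block K)) (dense : Dense B buf)
      (contents : contentsOf buf = contentsOf v.buf ++ ys) :
      Receives B v ys { v with buf := buf, size := v.size + ys.length }

theorem Dense.full_or_partial {B : ℕ} {bs : List (Block K)} (h : Dense B bs) :
    (∀ b ∈ bs, b.contents.length = B) ∨ ∃ init c, bs = init ++ [c] ∧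
      (∀ b ∈ init, b.contents.length = B) ∧ 0 < c.contents.length ∧ c.contents.length < B := by
  rcases List.eq_nil_or_concat' bs with rfl | ⟨init, c, rfl⟩
  · simp
  have init_full : ∀ b ∈ init, b.contents.length = B := fun b hb => h.2 b (by simpa using hb)
  obtain ⟨pos, le⟩ := h.1 c (by simp)
  rcases le.eq_or_lt with full | lt
  · exact Or.inl (List.forall_mem_append.2 ⟨init_full, by simpa using full⟩)
  · exact Or.inr ⟨init, c, rfl, init_full, pos, lt⟩

variable [LinearOrder K]

theorem runs_mergeFiles (P : Params) (hB : 0 < P.B) (n : ℕ) {as bs : List (Block K)}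
    (has : Dense P.B as) (hbs : Dense P.B bs)
    (hn : (contentsOf as).length + (contentsOf bs).length ≤ n) :
    ∃ out, Runs (mergeFiles P n as bs) out (as.length + bs.length) out.length 0 (3 * P.B) ∧
      Dense P.B out ∧
      contentsOf out = List.merge (contentsOf as) (contentsOf bs) fun a b => decide (a ≤ b) := by
  set p : Pair K := (Reader.start as, Reader.start bs)
  have merged : p.merged =
      List.merge (contentsOf as) (contentsOf bs) fun a b => decide (a ≤ b) := rfl
  have upTo_top : p.upTo ⊤ = p.merged := by
    rw [Pair.upTo, List.takeWhile_eq_self_iff]; simp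
  obtain ⟨out, q, delivers, dense, contents, out_runs⟩ := runs_emit P hB ⊤ n
    (p := p) ⟨Reader.ok_start has, Reader.ok_start hbs⟩
    (by rwa [upTo_top, merged, List.length_merge])
  rw [upTo_top] at delivers contents
  have held_q := Pair.held_eq_zero (List.append_right_eq_self.1 delivers.merged_eq.symm)
  have held_p : p.held = 0 := rfl
  have blocks_p : p.blocks = as.length + bs.length := rfl
  exact ⟨out, Runs.mono (out_runs.bind (Runs.pure _)), dense, contents⟩

theorem appendTo_eq_of_mod_eq_zero {σ : Type u} {P : Params} {v : Node K σ}
    (hv : v.size % P.B = 0) (n : ℕ) (p : Pair K) :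
    appendTo P n v p = (do
      let r ← emit P v.upper n p
      pure ({ v with buf := v.buf ++ r.1, size := v.size + r.2.1 }, r.2.2)) := by
  unfold appendTo
  split
  · simp_all
  · rfl

theorem appendTo_eq_of_mod_ne_zero {σ : Type u} {P : Params} {v : Node K σ}
    {init : List (Block K)} {c : Block K} (hbuf : v.buf = init ++ [c]) (hv : v.size % P.B ≠ 0)
    (n : ℕ) (p : Pair K) :
    appendTo P n v p = (do
      let ys ← load c
      let q ← pullMany v.upper (P.B - ys.length) p
      let b ← store (ys ++ q.1)
      let r ← emit P v.upper n q.2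
      pure ({ v with buf := init ++ (b :: r.1), size := v.size + (q.1.length + r.2.1) },
        r.2.2)) := by
  obtain ⟨m, hm⟩ := Nat.exists_eq_succ_of_ne_zero hv
  simp only [appendTo, hbuf, List.getLast?_concat, hm, List.dropLast_concat]

theorem runs_appendTo_of_full (P : Params) (hB : 0 < P.B) {σ : Type u} (n : ℕ) {v : Node K σ}
    {p : Pair K} (hp : p.Ok P.B) (hv : ∀ b ∈ v.buf, b.contents.length = P.B)
    (size_eq : v.size = (contentsOf v.buf).length) (hn : (p.upTo v.upper).length ≤ n) :
    ∃ v' q w, Runs (appendTo P n v p) (v', q) (p.blocks - q.blocks) w ((q.held : ℤ) - p.held)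
        (3 * P.B - p.held) ∧
      w * P.B ≤ (p.upTo v.upper).length + P.B ∧
      p.Delivers P.B (p.upTo v.upper) q ∧ v.Receives P.B (p.upTo v.upper) v' := by
  rw [appendTo_eq_of_mod_eq_zero (by rw [size_eq, length_contentsOf hv, Nat.mul_mod_left])]
  obtain ⟨bs, q, delivers, dense, contents, bs_runs⟩ := runs_emit P hB v.upper n hp hn
  have := delivers.ok.held_le
  exact ⟨_, q, bs.length, Runs.mono (bs_runs.bind (Runs.pure _)),
    contents ▸ dense.length_mul_le, delivers,
    .mk _ (.append hB hv dense) (by rw [contentsOf_append, contents])⟩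

theorem runs_appendTo_of_partial (P : Params) {σ : Type u} (n : ℕ) {v : Node K σ} {p : Pair K}
    (hp : p.Ok P.B) {init : List (Block K)} {c : Block K} (hbuf : v.buf = init ++ [c])
    (hinit : ∀ b ∈ init, b.contents.length = P.B) (c_pos : 0 < c.contents.length)
    (c_lt : c.contents.length < P.B) (size_eq : v.size = (contentsOf v.buf).length)
    (hn : (p.upTo v.upper).length ≤ n) :
    ∃ v' q w, Runs (appendTo P n v p) (v', q) (1 + (p.blocks - q.blocks)) w
        ((q.held : ℤ) - p.held) (4 * P.B - p.held) ∧
      w * P.B ≤ (p.upTo v.upper).length + 2 * P.B ∧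
      p.Delivers P.B (p.upTo v.upper) q ∧ v.Receives P.B (p.upTo v.upper) v' := by
  have hB : 0 < P.B := by omega
  have contents_v : contentsOf v.buf = contentsOf init ++ c.contents := by simp [hbuf]
  have mod_ne : v.size % P.B ≠ 0 := by
    rw [size_eq, contents_v, List.length_append, length_contentsOf hinit,
      Nat.mul_add_mod_self_right, Nat.mod_eq_of_lt c_lt]
    exact c_pos.ne'
  rw [appendTo_eq_of_mod_ne_zero hbuf mod_ne]
  set room := P.B - c.contents.length
  obtain ⟨q, fill, fill_runs⟩ := runs_pullMany v.upper room hp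
  have upTo_q := fill.upTo_eq_drop
  have upTo_split := List.take_append_drop room (p.upTo v.upper)
  obtain ⟨bs, q', rest, dense, contents, rest_runs⟩ :=
    runs_emit P hB v.upper n fill.ok (by rw [upTo_q, List.length_drop]; omega)
  rw [upTo_q] at rest contents rest_runs
  have length_split := congrArg List.length upTo_split
  rw [List.length_append] at length_split
  have bs_le := dense.length_mul_le
  rw [contents] at bs_le
  have := hp.held_le
  have := fill.ok.held_le
  have := rest.ok.held_le
  have := fill.blocks_le
  have := rest.blocks_le
  have := List.length_take_le room (p.upTo v.upper)
  have c_full : bs = [] ∨ (c.contents ++ (p.upTo v.upper).take room).length = P.B := by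
    rcases le_or_gt (p.upTo v.upper).length room with short | long
    · exact Or.inl (dense.eq_nil_of_contentsOf_eq_nil
        (by rw [contents, List.drop_of_length_le short]))
    · exact Or.inr (by rw [List.length_append, List.length_take_of_le long.le]; omega)
  refine ⟨_, q', bs.length + 1, Runs.mono ((runs_load_block c).bind (fill_runs.bind
    ((runs_store_block _).bind (rest_runs.bind (Runs.pure _)))))
    (hd := ?_) (hpk := ?_), ?_, upTo_split ▸ fill.trans rest, ?_⟩
  · simp only [List.length_append]; omega
  · simp only [List.length_append]; omega
  · rw [Nat.succ_mul]; omega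
  · rw [length_split]
    refine .mk _ (.append hB hinit (dense_cons.2 ⟨?_, c_full, dense⟩)) ?_
    · simp only [List.length_append]; omega
    · rw [contents_v, contentsOf_append, contentsOf_cons, contents, List.append_assoc,
        List.append_assoc, upTo_split]

theorem runs_appendTo (P : Params) (hB : 0 < P.B) {σ : Type u} (n : ℕ) {v : Node K σ} {p : Pair K}
    (hp : p.Ok P.B) (hv : Dense P.B v.buf) (size_eq : v.size = (contentsOf v.buf).length)
    (hn : (p.upTo v.upper).length ≤ n) :
    ∃ v' q w, Runs (appendTo P n v p) (v', q) (1 + (p.blocks - q.blocks)) w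
        ((q.held : ℤ) - p.held) (4 * P.B - p.held) ∧
      w * P.B ≤ (p.upTo v.upper).length + 2 * P.B ∧
      p.Delivers P.B (p.upTo v.upper) q ∧ v.Receives P.B (p.upTo v.upper) v' := by
  rcases hv.full_or_partial with full | ⟨init, c, hbuf, init_full, c_pos, c_lt⟩
  · obtain ⟨v', q, w, runs, hw, rest⟩ := runs_appendTo_of_full P hB n hp full size_eq hn
    exact ⟨v', q, w, Runs.mono runs, by omega, rest⟩
  · exact runs_appendTo_of_partial P n hp hbuf init_full c_pos c_lt size_eq hn

/-- `Distributed B cs zs cs'`: the children `cs'` arise from `cs` by appending to the buffer of each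
child those records of the sorted list `zs` that belong to it. -/
inductive Distributed {σ : Type u} (B : ℕ) :
    List (Stored (Node K σ)) → List K → List (Stored (Node K σ)) → Prop
  | nil : Distributed B [] [] []
  | cons {c : Stored (Node K σ)} {cs cs' : List (Stored (Node K σ))} {ys zs : List K}
      {v : Node K σ} (receives : c.contents.Receives B ys v)
      (le_upper : ∀ y ∈ ys, (y : WithTop K) ≤ c.contents.upper)
      (upper_lt : ∀ z ∈ zs, c.contents.upper < (z : WithTop K))
      (tail : Distributed B cs zs cs') : Distributed B (c :: cs) (ys ++ zs) (⟨v⟩ :: cs')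

theorem Pair.le_of_mem_upTo {u : WithTop K} {p : Pair K} {y : K} (h : y ∈ p.upTo u) :
    (y : WithTop K) ≤ u :=
  of_decide_eq_true (List.mem_takeWhile_imp (p := fun z : K => decide ((z : WithTop K) ≤ u)) h)

theorem Pair.Delivers.lt_of_mem_merged {B : ℕ} {u : WithTop K} {p q : Pair K}
    (h : p.Delivers B (p.upTo u) q) (sorted : p.merged.Pairwise (· < ·)) {z : K}
    (hz : z ∈ q.merged) : u < (z : WithTop K) := by
  have q_merged : q.merged = p.merged.dropWhile fun z : K => decide ((z : WithTop K) ≤ u) :=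
    List.append_cancel_left (as := p.upTo u)
      (h.merged_eq.symm.trans List.takeWhile_append_dropWhile.symm)
  have q_sorted := (List.pairwise_append.1 (h.merged_eq ▸ sorted)).2.1
  rcases q_cons : q.merged with _ | ⟨y, ys⟩
  · simp [q_cons] at hz
  have lt_y : u < (y : WithTop K) := by
    have := List.head?_dropWhile_not (fun z : K => decide ((z : WithTop K) ≤ u)) p.merged
    simpa [← q_merged, q_cons] using this
  rw [q_cons] at hz q_sorted
  rcases List.mem_cons.1 hz with rfl | hz
  · exact lt_y
  · exact lt_y.trans (WithTop.coe_lt_coe.2 (List.rel_of_pairwise_cons q_sorted hz))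

theorem runs_distribute (P : Params) (hB : 0 < P.B) {σ : Type u} (n : ℕ)
    {cs : List (Stored (Node K σ))} {p : Pair K} (hp : p.Ok P.B)
    (hcs : ∀ c ∈ cs, Dense P.B c.contents.buf ∧
      c.contents.size = (contentsOf c.contents.buf).length)
    (sorted : p.merged.Pairwise (· < ·)) (hn : p.merged.length ≤ n)
    (hlast : ∀ z ∈ p.merged, ∃ c ∈ cs.getLast?, (z : WithTop K) ≤ c.contents.upper) :
    ∃ cs' w, Runs (distribute P n cs p) cs' (2 * cs.length + p.blocks) w (-(p.held : ℤ))
        (1 + 4 * P.B - p.held) ∧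
      w * P.B ≤ p.merged.length + 3 * (cs.length * P.B) ∧ Distributed P.B cs p.merged cs' := by
  induction cs generalizing p with
  | nil =>
    have merged_nil : p.merged = [] :=
      List.eq_nil_iff_forall_not_mem.2 fun z hz => by simpa using hlast z hz
    have := Pair.held_eq_zero merged_nil
    exact ⟨[], 0, Runs.mono (Runs.pure _), by simp, merged_nil ▸ .nil⟩
  | cons c cs ih =>
    rw [List.forall_mem_cons] at hcs
    have upTo_le : (p.upTo c.contents.upper).length ≤ p.merged.length :=
      (List.takeWhile_sublist _).length_le
    obtain ⟨v, q, w, append_runs, hw, delivers, receives⟩ :=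
      runs_appendTo P hB n hp hcs.1.1 hcs.1.2 (upTo_le.trans hn)
    have length_merged := congrArg List.length delivers.merged_eq
    rw [List.length_append] at length_merged
    have upper_lt : ∀ z ∈ q.merged, c.contents.upper < (z : WithTop K) := fun _ =>
      delivers.lt_of_mem_merged sorted
    have q_sorted := (List.pairwise_append.1 (delivers.merged_eq ▸ sorted)).2.1
    obtain ⟨cs', w', rest_runs, hw', distributed⟩ :=
      ih delivers.ok hcs.2 q_sorted (by omega) fun z hz => by
        obtain ⟨d, hd, hzd⟩ := hlast z (by simp [delivers.merged_eq, hz])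
        rcases cs with _ | ⟨c', cs⟩
        · obtain rfl : c = d := by simpa using hd
          exact absurd hzd (upper_lt z hz).not_ge
        · exact ⟨d, by simpa using hd, hzd⟩
    have := delivers.blocks_le
    have := delivers.ok.held_le
    have := hp.held_le
    have all := Distributed.cons receives (fun _ => Pair.le_of_mem_upTo) upper_lt distributed
    refine ⟨_, w + w' + 1, ?_, ?_, delivers.merged_eq ▸ all⟩
    · rw [List.length_cons]
      exact Runs.mono ((runs_load_node c).bind (append_runs.bind ((runs_store_node _).bind
        (rest_runs.bind (Runs.pure _)))))
    · rw [List.length_cons]; linarith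

end Distribution

/-! ### Trees during a buffer-emptying process -/

section Trees

variable {K : Type u} {h : ℕ}

/-- The records below a list of children. -/
def childRecords (h : ℕ) (cs : List (Stored (Tree K h))) : List K :=
  (cs.map fun c => recordsOf h c.contents).flatten

@[simp] theorem childRecords_nil : childRecords h ([] : List (Stored (Tree K h))) = [] :=
  rfl

@[simp] theorem childRecords_cons (c : Stored (Tree K h)) (cs : List (Stored (Tree K h))) :
    childRecords h (c :: cs) = recordsOf h c.contents ++ childRecords h cs :=
  rfl

theorem mem_childRecords {cs : List (Stored (Tree K h))} {x : K} :
    x ∈ childRecords h cs ↔ ∃ c ∈ cs, x ∈ recordsOf h c.contents := by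
  simp [childRecords]

theorem childRecords_append (cs ds : List (Stored (Tree K h))) :
    childRecords h (cs ++ ds) = childRecords h cs ++ childRecords h ds := by
  simp [childRecords]

theorem recordsOf_zero (v : Tree K 0) : recordsOf 0 v = contentsOf v.buf ++ contentsOf v.body :=
  rfl

theorem recordsOf_succ (v : Tree K (h + 1)) :
    recordsOf (h + 1) v = contentsOf v.buf ++ childRecords h v.body :=
  rfl

theorem Node.Receives.records_perm {B : ℕ} {v v' : Tree K h} {ys : List K}
    (hv' : v.Receives B ys v') : (recordsOf h v').Perm (recordsOf h v ++ ys) := by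
  obtain ⟨buf, -, contents⟩ := hv'
  cases h with
  | zero =>
    simp only [recordsOf_zero, contents, List.append_assoc]
    exact List.perm_append_comm.append_left _
  | succ h =>
    simp only [recordsOf_succ, contents, List.append_assoc]
    exact List.perm_append_comm.append_left _

/-- The potential of a subtree in the amortized analysis: `wt i` for each record in a buffer at
height `i`, and `e` for each emptied node. -/
def credit (wt : ℕ → ℕ) (e : ℕ) : (h : ℕ) → Tree K h → ℕ
  | 0, v => wt 0 * (contentsOf v.buf).length
  | h + 1, v => wt (h + 1) * (contentsOf v.buf).length + (if v.emptied then e else 0) +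
      (List.map (fun c : Stored (Tree K h) => credit wt e h c.contents) v.body).sum

theorem Node.Receives.credit_eq {B e : ℕ} {wt : ℕ → ℕ} {v v' : Tree K h} {ys : List K}
    (hv' : v.Receives B ys v') : credit wt e h v' = credit wt e h v + wt h * ys.length := by
  obtain ⟨buf, -, contents⟩ := hv'
  cases h with
  | zero => simp only [credit, contents, List.length_append]; ring
  | succ h => simp only [credit, contents, List.length_append]; ring

/-- A buffer to which sorted records may have been appended after it became full: it is dense, and
sorted beyond the first `lB` records. -/
structure BufferOK [LinearOrder K] (l B : ℕ) {σ : Type u} (v : Node K σ) : Prop where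
  dense : Dense B v.buf
  size_eq : v.size = (contentsOf v.buf).length
  sorted : ((contentsOf v.buf).drop (l * B)).Pairwise (· < ·)

variable [LinearOrder K]

/-- The keys separate the subtrees. -/
def Separated (h : ℕ) (cs : List (Stored (Tree K h))) : Prop :=
  cs.Pairwise fun c d : Stored (Tree K h) => c.contents.upper < d.contents.upper ∧
    ∀ x ∈ recordsOf h d.contents, c.contents.upper < (x : WithTop K)

/-- What `NodeOK` requires of the records of a leaf outside its buffer. -/
structure LeafShape (l B : ℕ) (isRoot : Bool) (v : Tree K 0) : Prop where
  dense : Dense B v.body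
  sorted : (contentsOf v.body).Pairwise (· < ·)
  length_le : List.length v.body ≤ l
  records_le : (contentsOf v.body).length ≤ l * B
  le_records : isRoot = false → l * B ≤ 4 * (contentsOf v.body).length

/-- What `NodeOK` requires of the number and the keys of the children of an internal node. -/
structure InternalShape (l h : ℕ) (isRoot : Bool) (v : Tree K (h + 1)) : Prop where
  length_le : List.length v.body ≤ l
  two_le : 2 ≤ List.length v.body
  le_length : isRoot = false → l ≤ 4 * List.length v.body
  separated : Separated h v.body
  last_upper : ∀ c ∈ List.getLast? (v.body : List (Stored (Tree K h))), c.contents.upper = v.upper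

/-- What `NodeOK` requires of a node apart from its buffer and its bound. -/
def BodyOK (l B : ℕ) : (h : ℕ) → (isRoot : Bool) → Tree K h → Prop
  | 0, isRoot, v => LeafShape l B isRoot v
  | h + 1, isRoot, v => v.emptied = false ∧ InternalShape l h isRoot v ∧
      ∀ c ∈ (v.body : List (Stored (Tree K h))), NodeOK l B h false c.contents

/-- A node that is as in `NodeOK`, except that its buffer may be full. -/
structure Receiving (l B h : ℕ) (isRoot : Bool) (v : Tree K h) : Prop where
  bufferOK : BufferOK l B v
  le_upper : ∀ x ∈ recordsOf h v, (x : WithTop K) ≤ v.upper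
  bodyOK : BodyOK l B h isRoot v

/-- A node after the first phase of a buffer-emptying process: only leaves can be full. -/
inductive Drained (l B : ℕ) : (h : ℕ) → (isRoot : Bool) → Tree K h → Prop
  | leaf {isRoot : Bool} {v : Tree K 0} (receiving : Receiving l B 0 isRoot v) :
      Drained l B 0 isRoot v
  | untouched {h : ℕ} {isRoot : Bool} {v : Tree K (h + 1)} (ok : NodeOK l B (h + 1) isRoot v) :
      Drained l B (h + 1) isRoot v
  | emptied {h : ℕ} {isRoot : Bool} {v : Tree K (h + 1)} (emptied_eq : v.emptied = true)
      (buf_eq : v.buf = []) (shape : InternalShape l h isRoot v)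
      (children : ∀ c ∈ (v.body : List (Stored (Tree K h))), Drained l B h false c.contents) :
      Drained l B (h + 1) isRoot v

variable {l B : ℕ} {isRoot : Bool}

theorem nodeOK_iff {v : Tree K h} :
    NodeOK l B h isRoot v ↔ Receiving l B h isRoot v ∧ v.size < l * B := by
  have bufferOK (dense : Dense B v.buf) (size_eq : v.size = (contentsOf v.buf).length)
      (size_lt : v.size < l * B) : BufferOK l B v :=
    ⟨dense, size_eq, by rw [List.drop_eq_nil_of_le (by omega)]; exact List.Pairwise.nil⟩
  cases h with
  | zero =>
    constructor
    · rintro ⟨dense, size_eq, size_lt, le_upper, body_dense, sorted, length_le, records_le,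
        le_records⟩
      exact ⟨⟨bufferOK dense size_eq size_lt, le_upper,
        ⟨body_dense, sorted, length_le, records_le, le_records⟩⟩, size_lt⟩
    · rintro ⟨⟨buf, le_upper, leaf⟩, size_lt⟩
      exact ⟨buf.dense, buf.size_eq, size_lt, le_upper, leaf.dense, leaf.sorted, leaf.length_le,
        leaf.records_le, leaf.le_records⟩
  | succ h =>
    constructor
    · rintro ⟨dense, size_eq, size_lt, le_upper, emptied, length_le, two_le, le_length, children,
        separated, last_upper⟩
      exact ⟨⟨bufferOK dense size_eq size_lt, le_upper, emptied,
        ⟨length_le, two_le, le_length, separated, last_upper⟩, children⟩, size_lt⟩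
    · rintro ⟨⟨buf, le_upper, emptied, shape, children⟩, size_lt⟩
      exact ⟨buf.dense, buf.size_eq, size_lt, le_upper, emptied, shape.length_le, shape.two_le,
        shape.le_length, children, shape.separated, shape.last_upper⟩

theorem NodeOK.receiving {v : Tree K h} (hv : NodeOK l B h isRoot v) : Receiving l B h isRoot v :=
  (nodeOK_iff.1 hv).1

theorem NodeOK.size_lt {v : Tree K h} (hv : NodeOK l B h isRoot v) : v.size < l * B :=
  (nodeOK_iff.1 hv).2

theorem BodyOK.receives {v v' : Tree K h} {ys : List K} (hv : BodyOK l B h isRoot v)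
    (hv' : v.Receives B ys v') : BodyOK l B h isRoot v' := by
  obtain ⟨buf, -, -⟩ := hv'
  cases h with
  | zero => exact ⟨hv.dense, hv.sorted, hv.length_le, hv.records_le, hv.le_records⟩
  | succ h =>
    obtain ⟨emptied, shape, children⟩ := hv
    exact ⟨emptied, ⟨shape.length_le, shape.two_le, shape.le_length, shape.separated,
      shape.last_upper⟩, children⟩

/-- Sortedness beyond the first `lB` records survives because the receiving buffer was not full. -/
theorem NodeOK.receives {v v' : Tree K h} {ys : List K} (hv : NodeOK l B h isRoot v)
    (hv' : v.Receives B ys v')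
    (sorted : ((contentsOf v.buf ++ ys).drop (l * B)).Pairwise (· < ·))
    (hys : ∀ y ∈ ys, (y : WithTop K) ≤ v.upper) : Receiving l B h isRoot v' where
  bufferOK := by
    obtain ⟨buf, dense, contents⟩ := hv'
    exact ⟨dense, by simp [contents, hv.receiving.bufferOK.size_eq], by simpa only [contents]⟩
  le_upper x hx := by
    have upper_eq : v'.upper = v.upper := by obtain ⟨buf, -, -⟩ := hv'; rfl
    rw [upper_eq]
    rcases List.mem_append.1 (hv'.records_perm.mem_iff.1 hx) with hx | hx
    exacts [hv.receiving.le_upper x hx, hys x hx]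
  bodyOK := hv.receiving.bodyOK.receives hv'

end Trees

section Distributed

variable {K : Type u} [LinearOrder K] {B h : ℕ} {cs cs' : List (Stored (Tree K h))} {zs : List K}

theorem Distributed.map_upper (hd : Distributed B cs zs cs') :
    cs'.map (fun c => c.contents.upper) = cs.map fun c => c.contents.upper := by
  induction hd with
  | nil => rfl
  | cons receives _ _ _ ih => cases receives; simp only [List.map_cons, ih]

theorem Distributed.childRecords_perm (hd : Distributed B cs zs cs') :
    (childRecords h cs').Perm (childRecords h cs ++ zs) := by
  induction hd with
  | nil => simp
  | @cons c cs cs' ys zs v receives _ _ _ ih =>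
    refine (receives.records_perm.append ih).trans ?_
    simp only [childRecords_cons, List.append_assoc]
    exact (List.perm_append_comm_assoc ..).append_left _

theorem Distributed.sum_credit {e : ℕ} {wt : ℕ → ℕ} (hd : Distributed B cs zs cs') :
    (cs'.map fun c => credit wt e h c.contents).sum =
      (cs.map fun c => credit wt e h c.contents).sum + wt h * zs.length := by
  induction hd with
  | nil => simp
  | cons receives _ _ _ ih =>
    simp only [List.map_cons, List.sum_cons, ih, receives.credit_eq, List.length_append]
    ring

theorem Distributed.separated (hd : Distributed B cs zs cs') (hcs : Separated h cs) :
    Separated h cs' := by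
  induction hd with
  | nil => exact List.Pairwise.nil
  | @cons c cs cs' ys zs v receives _ upper_lt tail ih =>
    obtain ⟨c_lt, hcs⟩ := List.pairwise_cons.1 hcs
    have upper_eq : v.upper = c.contents.upper := by cases receives; rfl
    refine List.pairwise_cons.2 ⟨fun d hd => ?_, ih hcs⟩
    simp only [upper_eq]
    constructor
    · have hmem := List.mem_map_of_mem (f := fun c => c.contents.upper) hd
      rw [tail.map_upper] at hmem
      obtain ⟨d', hd', upper_d⟩ := List.mem_map.1 hmem
      exact upper_d ▸ (c_lt d' hd').1
    · intro x hx
      rcases List.mem_append.1 (tail.childRecords_perm.mem_iff.1 (mem_childRecords.2 ⟨d, hd, hx⟩))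
        with hx | hx
      · obtain ⟨d', hd', hx'⟩ := mem_childRecords.1 hx
        exact (c_lt d' hd').2 x hx'
      · exact upper_lt x hx

theorem Distributed.receiving {l : ℕ} (hd : Distributed B cs zs cs')
    (hcs : ∀ c ∈ cs, NodeOK l B h false c.contents) (sorted : zs.Pairwise (· < ·)) :
    ∀ c ∈ cs', Receiving l B h false c.contents := by
  induction hd with
  | nil => simp
  | @cons c cs cs' ys zs v receives le_upper _ _ ih =>
    obtain ⟨ys_sorted, zs_sorted, -⟩ := List.pairwise_append.1 sorted
    obtain ⟨hc, hcs⟩ := List.forall_mem_cons.1 hcs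
    refine List.forall_mem_cons.2 ⟨hc.receives receives ?_ le_upper, ih hcs zs_sorted⟩
    have not_full := hc.receiving.bufferOK.size_eq ▸ hc.size_lt
    rw [List.drop_append, List.drop_eq_nil_of_le not_full.le, List.nil_append]
    exact ys_sorted.drop

end Distributed

section Params

/-- The standing assumptions on the parameters of a buffer tree. -/
structure Params.Valid (P : Params) : Prop where
  one_le_k : 1 ≤ P.k
  one_le_B : 1 ≤ P.B
  dvd : P.B ∣ P.M
  le_l : 8 ≤ P.l

namespace Params.Valid

variable {P : Params}

theorem l_eq (hP : P.Valid) : P.l = P.k * (P.M / P.B) := Nat.mul_div_assoc _ hP.dvd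

theorem l_mul_B (hP : P.Valid) : P.l * P.B = P.k * P.M := by
  rw [hP.l_eq, mul_assoc, Nat.div_mul_cancel hP.dvd]

theorem M_pos (hP : P.Valid) : 0 < P.M := by
  refine Nat.pos_of_ne_zero fun hM => ?_
  have := hP.le_l
  simp [Params.l, hM] at this

theorem B_le_M (hP : P.Valid) : P.B ≤ P.M := Nat.le_of_dvd hP.M_pos hP.dvd

theorem B_le (hP : P.Valid) : 8 * P.B ≤ P.l * P.B := Nat.mul_le_mul_right _ hP.le_l

end Params.Valid

end Params

/-! ### The first phase -/

section Loops

variable {α β : Type u}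

theorem sum_map_add_le {g : α → β} {w f : α → ℕ} {f' : β → ℕ} {B : ℕ} (as : List α)
    (h : ∀ a ∈ as, B * w a + f' (g a) ≤ f a + B) :
    B * (as.map w).sum + ((as.map g).map f').sum ≤ (as.map f).sum + as.length * B := by
  induction as with
  | nil => simp
  | cons a as ih =>
    obtain ⟨head, tail⟩ := List.forall_mem_cons.1 h
    simp only [List.map_cons, List.sum_cons, List.length_cons, Nat.mul_add, Nat.succ_mul]
    linarith [ih tail]

theorem exists_runs_forEach {f : α → Prog β} {R : α → β → ℕ → Prop} {k : ℕ} {pk : ℤ}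
    (hpk : 0 ≤ pk) (as : List α)
    (h : ∀ a ∈ as, ∃ b w, Runs (f a) b (k * w) w 0 pk ∧ R a b w) :
    ∃ (g : α → β) (w : α → ℕ),
      Runs (forEach f as) (as.map g) (k * (as.map w).sum) (as.map w).sum 0 pk ∧
        ∀ a ∈ as, R a (g a) (w a) := by
  have total (a : α) : ∃ b w, a ∈ as → Runs (f a) b (k * w) w 0 pk ∧ R a b w := by
    by_cases ha : a ∈ as
    · obtain ⟨b, w, hbw⟩ := h a ha
      exact ⟨b, w, fun _ => hbw⟩
    · exact ⟨(f a Meter.zero).1, 0, fun h => absurd h ha⟩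
  choose g w hgw using total
  refine ⟨g, w, ?_, fun a ha => (hgw a ha).2⟩
  rw [← List.sum_map_mul_left]
  exact runs_forEach hpk as fun a ha => (hgw a ha).1

end Loops

section SortedBuffer

variable {K : Type u} [LinearOrder K]

theorem pairwise_lt_merge {xs ys : List K} (hx : xs.Pairwise (· ≤ ·)) (hy : ys.Pairwise (· ≤ ·))
    (hnd : (xs ++ ys).Nodup) :
    (List.merge xs ys fun a b => decide (a ≤ b)).Pairwise (· < ·) := by
  have sorted : (List.merge xs ys fun a b => decide (a ≤ b)).Pairwise (· ≤ ·) :=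
    List.Pairwise.merge hx hy
  have nodup : (List.merge xs ys fun a b => decide (a ≤ b)).Nodup :=
    (List.merge_perm_append _).nodup_iff.2 hnd
  exact (sorted.and nodup).imp fun h => lt_of_le_of_ne h.1 h.2

/-- The blocks `as` and `bs` hold the records of `buf` and can be merged to a sorted sequence. -/
structure SortedPair (B : ℕ) (buf as bs : List (Block K)) : Prop where
  left_dense : Dense B as
  right_dense : Dense B bs
  length_add : as.length + bs.length = buf.length
  merge_perm : (List.merge (contentsOf as) (contentsOf bs) fun a b => decide (a ≤ b)).Perm
    (contentsOf buf)
  merge_sorted : (List.merge (contentsOf as) (contentsOf bs) fun a b => decide (a ≤ b)).Pairwise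
    (· < ·)

theorem runs_sortBuffer {P : Params} (hP : P.Valid) {σ : Type u} {v : Node K σ}
    (hv : BufferOK P.l P.B v) (hfull : P.l * P.B ≤ v.size) (hnd : (contentsOf v.buf).Nodup) :
    ∃ s, Runs (selectionSort P P.k ⊥ (v.buf.take P.l)) s (P.k * P.l) P.l 0 (P.M + P.B) ∧
      SortedPair P.B v.buf s (v.buf.drop P.l) := by
  have hB := hP.one_le_B
  obtain ⟨take_length, take_full⟩ := hv.dense.length_take_and_full hB (hv.size_eq ▸ hfull)
  have contents : contentsOf v.buf =
      contentsOf (v.buf.take P.l) ++ contentsOf (v.buf.drop P.l) := by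
    rw [← contentsOf_append, List.take_append_drop]
  have take_records : (contentsOf (v.buf.take P.l)).length = P.l * P.B := by
    rw [length_contentsOf take_full, take_length]
  have drop_sorted : (contentsOf (v.buf.drop P.l)).Pairwise (· < ·) := by
    have sorted := hv.sorted
    rwa [contents, ← take_records, List.drop_left] at sorted
  rw [contents] at hnd
  obtain ⟨s, sort_runs, s_full, s_contents⟩ := runs_selectionSort P hB hP.M_pos hP.dvd _
    (fun b hb => (take_full b hb).le) hnd.of_append_left P.k ⊥
    (by rw [above_bot, take_records, hP.l_mul_B])
  rw [above_bot] at s_contents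
  have s_perm : (contentsOf s).Perm (contentsOf (v.buf.take P.l)) :=
    s_contents ▸ List.perm_insertionSort _ _
  have s_length : s.length = P.l := by
    have records := s_perm.length_eq
    rw [length_contentsOf s_full, take_records] at records
    exact Nat.eq_of_mul_eq_mul_right hB records
  rw [take_length, ← hP.l_eq] at sort_runs
  refine ⟨s, sort_runs, ?_, ?_, ?_, ?_, ?_⟩
  · simpa using Dense.append hB s_full (dense_nil _)
  · exact Dense.of_append_right ((List.take_append_drop P.l v.buf).symm ▸ hv.dense)
  · have split_length := congrArg List.length (List.take_append_drop P.l v.buf)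
    rw [List.length_append, take_length] at split_length
    rw [s_length]
    exact split_length
  · rw [contents]
    exact (List.merge_perm_append _).trans (s_perm.append_right _)
  · exact pairwise_lt_merge (s_contents ▸ List.pairwise_insertionSort _ _)
      (drop_sorted.imp le_of_lt) ((s_perm.append_right _).nodup_iff.2 hnd)

end SortedBuffer

section FirstPhase

variable {K : Type u} {h : ℕ}

theorem childRecords_map_perm {cs : List (Stored (Tree K h))}
    {g : Stored (Tree K h) → Stored (Tree K h)}
    (hg : ∀ c ∈ cs, (recordsOf h (g c).contents).Perm (recordsOf h c.contents)) :
    (childRecords h (cs.map g)).Perm (childRecords h cs) := by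
  induction cs with
  | nil => rfl
  | cons c cs ih =>
    obtain ⟨head, tail⟩ := List.forall_mem_cons.1 hg
    exact head.append (ih tail)

theorem nodup_of_mem_childRecords {cs : List (Stored (Tree K h))}
    (hn : (childRecords h cs).Nodup) {c : Stored (Tree K h)} (hc : c ∈ cs) :
    (recordsOf h c.contents).Nodup :=
  (List.nodup_flatten.1 hn).1 _ (List.mem_map_of_mem hc)

variable [LinearOrder K]

theorem Separated.map {cs : List (Stored (Tree K h))} {g : Stored (Tree K h) → Stored (Tree K h)}
    (hs : Separated h cs) (hu : ∀ c ∈ cs, (g c).contents.upper = c.contents.upper)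
    (hr : ∀ c ∈ cs, (recordsOf h (g c).contents).Perm (recordsOf h c.contents)) :
    Separated h (cs.map g) := by
  rw [Separated, List.pairwise_map]
  refine List.Pairwise.imp_of_mem (fun {c d} hc hd hcd => ?_) hs
  rw [hu c hc, hu d hd]
  exact ⟨hcd.1, fun x hx => hcd.2 x ((hr d hd).mem_iff.1 hx)⟩

theorem InternalShape.congr {l : ℕ} {isRoot : Bool} {v v' : Tree K (h + 1)}
    (hv : InternalShape l h isRoot v) (upper_eq : v'.upper = v.upper)
    (map_upper : List.map (fun c : Stored (Tree K h) => c.contents.upper) v'.body =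
      List.map (fun c : Stored (Tree K h) => c.contents.upper) v.body)
    (separated : Separated h v'.body) : InternalShape l h isRoot v' := by
  have length_eq : List.length v'.body = List.length v.body := by
    simpa using congrArg List.length map_upper
  refine ⟨length_eq ▸ hv.length_le, length_eq ▸ hv.two_le, length_eq ▸ hv.le_length, separated,
    fun d hd => ?_⟩
  have last_eq := congrArg List.getLast? map_upper
  rw [List.getLast?_map, List.getLast?_map, Option.mem_def.1 hd] at last_eq
  obtain ⟨c, hc, c_upper⟩ := Option.map_eq_some_iff.1 last_eq.symm
  rw [upper_eq, ← hv.last_upper c hc, c_upper]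

/-- What the first phase achieves below the node `v`, which becomes `v'`, with `w` block writes. -/
structure EmptiesTo (l B : ℕ) (wt : ℕ → ℕ) (h : ℕ) (isRoot : Bool) (v v' : Tree K h) (w : ℕ) :
    Prop where
  drained : Drained l B h isRoot v'
  upper_eq : v'.upper = v.upper
  buf_eq : v'.buf = [] ∨ v'.buf = v.buf
  records_perm : (recordsOf h v').Perm (recordsOf h v)
  credit_le : B * w + credit wt (3 * (l * B)) h v' ≤ credit wt (3 * (l * B)) h v + B

/-- A node as `emptyDown` leaves it: its buffer has been distributed, and the children that
received the records have been treated by `g`. -/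
def Node.emptiedWith (v : Tree K (h + 1)) (cs : List (Stored (Tree K h)))
    (g : Stored (Tree K h) → Stored (Tree K h)) : Tree K (h + 1) :=
  { v with buf := [], size := 0, emptied := true, body := cs.map g }

variable {P : Params} {wt : ℕ → ℕ} {isRoot : Bool} {v : Tree K (h + 1)}
  {cs : List (Stored (Tree K h))} {zs : List K} {wd : ℕ} {w : Stored (Tree K h) → ℕ}
  {g : Stored (Tree K h) → Stored (Tree K h)}

theorem runs_distributeBuffer (hP : P.Valid) (hv : Receiving P.l P.B (h + 1) isRoot v)
    (hfull : P.l * P.B ≤ v.size) (hnd : (recordsOf (h + 1) v).Nodup) :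
    ∃ s cs wd zs,
      Runs (selectionSort P P.k ⊥ (v.buf.take P.l)) s (P.k * P.l) P.l 0 (P.M + P.B) ∧
      Runs (distribute P v.size v.body (Reader.start s, Reader.start (v.buf.drop P.l))) cs
        (2 * List.length v.body + v.buf.length) wd 0 (1 + 4 * P.B) ∧
      wd * P.B ≤ v.size + 3 * (List.length v.body * P.B) ∧
      zs.Perm (contentsOf v.buf) ∧ zs.Pairwise (· < ·) ∧ Distributed P.B v.body zs cs := by
  obtain ⟨-, shape, children⟩ := hv.bodyOK
  obtain ⟨s, sort_runs, sorted⟩ := runs_sortBuffer hP hv.bufferOK hfull hnd.of_append_left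
  set p : Pair K := (Reader.start s, Reader.start (v.buf.drop P.l))
  have merged_perm : p.merged.Perm (contentsOf v.buf) := sorted.merge_perm
  have merged_length : p.merged.length = v.size := by
    rw [merged_perm.length_eq, hv.bufferOK.size_eq]
  obtain ⟨cs, wd, distribute_runs, wd_le, distributed⟩ := runs_distribute P hP.one_le_B v.size
    (cs := v.body) (p := p) ⟨Reader.ok_start sorted.left_dense, Reader.ok_start sorted.right_dense⟩
    (fun c hc => have := (children c hc).receiving.bufferOK; ⟨this.dense, this.size_eq⟩)
    sorted.merge_sorted merged_length.le fun z hz => by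
      have body_ne : (v.body : List (Stored (Tree K h))) ≠ [] :=
        List.ne_nil_of_length_pos (by have := shape.two_le; omega)
      refine ⟨_, List.getLast?_eq_getLast_of_ne_nil body_ne, ?_⟩
      rw [shape.last_upper _ (List.getLast?_eq_getLast_of_ne_nil body_ne)]
      exact hv.le_upper z (List.mem_append_left _ (merged_perm.mem_iff.1 hz))
  rw [merged_length] at wd_le
  have held : p.held = 0 := rfl
  have blocks : p.blocks = v.buf.length := sorted.length_add
  exact ⟨s, cs, wd, p.merged, sort_runs, distribute_runs.mono, wd_le, merged_perm,
    sorted.merge_sorted, distributed⟩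

theorem Distributed.perm_recordsOf (hd : Distributed P.B v.body zs cs)
    (hzs : zs.Perm (contentsOf v.buf)) : (childRecords h cs).Perm (recordsOf (h + 1) v) :=
  hd.childRecords_perm.trans ((hzs.append_left _).trans List.perm_append_comm)

theorem drained_emptiedWith (hv : Receiving P.l P.B (h + 1) isRoot v)
    (hd : Distributed P.B v.body zs cs)
    (hg : ∀ c ∈ cs, EmptiesTo P.l P.B wt h false c.contents (g c).contents (w c)) :
    Drained P.l P.B (h + 1) isRoot (v.emptiedWith cs g) := by
  obtain ⟨-, shape, -⟩ := hv.bodyOK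
  refine Drained.emptied rfl rfl
    (shape.congr rfl ?_ ((hd.separated shape.separated).map (fun c hc => (hg c hc).upper_eq)
      fun c hc => (hg c hc).records_perm)) (List.forall_mem_map.2 fun c hc => (hg c hc).drained)
  rw [← hd.map_upper]
  exact List.map_map.trans (List.map_congr_left fun c hc => (hg c hc).upper_eq)

/-- The records move down one level, which pays `13` per record for emptying the node. -/
theorem credit_emptiedWith_le (hP : P.Valid) (hwt : wt h + 13 ≤ wt (h + 1))
    (hv : Receiving P.l P.B (h + 1) isRoot v) (hfull : P.l * P.B ≤ v.size)
    (hd : Distributed P.B v.body zs cs) (hzs : zs.Perm (contentsOf v.buf))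
    (hwd : wd * P.B ≤ v.size + 3 * (List.length v.body * P.B))
    (hg : ∀ c ∈ cs, EmptiesTo P.l P.B wt h false c.contents (g c).contents (w c)) :
    P.B * (2 + P.l + 2 * List.length v.body + v.buf.length + wd + (cs.map w).sum) +
        credit wt (3 * (P.l * P.B)) (h + 1) (v.emptiedWith cs g) ≤
      credit wt (3 * (P.l * P.B)) (h + 1) v + P.B := by
  obtain ⟨emptied, shape, -⟩ := hv.bodyOK
  have size_eq := hv.bufferOK.size_eq
  have children := sum_map_add_le (B := P.B)
    (f := fun c : Stored (Tree K h) => credit wt (3 * (P.l * P.B)) h c.contents)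
    (f' := fun c : Stored (Tree K h) => credit wt (3 * (P.l * P.B)) h c.contents) cs
    fun c hc => (hg c hc).credit_le
  have cs_length : cs.length = List.length v.body := by
    simpa using congrArg List.length hd.map_upper
  rw [hd.sum_credit, cs_length, hzs.length_eq, ← size_eq] at children
  have buf_le := hv.bufferOK.dense.length_mul_le
  have body_le : List.length v.body * P.B ≤ P.l * P.B := Nat.mul_le_mul_right _ shape.length_le
  have B_le := hP.B_le
  have weights := Nat.mul_le_mul_right v.size hwt
  rw [Nat.add_mul] at weights
  simp only [credit, Node.emptiedWith, emptied, contentsOf_nil, List.length_nil, ← size_eq,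
    if_true, Bool.false_eq_true, if_false]
  rw [← size_eq] at buf_le
  linarith

theorem runs_emptyDown (hP : P.Valid) (hwt : ∀ h, wt h + 13 ≤ wt (h + 1)) {c : Stored (Tree K h)}
    (hc : Receiving P.l P.B h isRoot c.contents) (hnd : (recordsOf h c.contents).Nodup) :
    ∃ c' w, Runs (emptyDown P h c) c' (P.k * w) w 0 (P.M + 6 * P.B) ∧
      EmptiesTo P.l P.B wt h isRoot c.contents c'.contents w := by
  have hk := hP.one_le_k
  have hB := hP.one_le_B
  induction h generalizing isRoot with
  | zero =>
    exact ⟨c, 0, Runs.mono (Runs.pure _), .leaf hc, rfl, .inr rfl, .refl _, by omega⟩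
  | succ h ih =>
    by_cases hsize : c.contents.size < P.l * P.B
    · exact ⟨c, 1, Runs.mono ((runs_load_node c).bind (Runs.ite_pos hsize
          ((runs_release 1).bind (Runs.pure _)))),
        .untouched (nodeOK_iff.2 ⟨hc, hsize⟩), rfl, .inr rfl, .refl _, by omega⟩
    obtain ⟨-, -, children⟩ := hc.bodyOK
    obtain ⟨s, cs, wd, zs, sort_runs, distribute_runs, wd_le, zs_perm, zs_sorted, distributed⟩ :=
      runs_distributeBuffer hP hc (not_lt.1 hsize) hnd
    have cs_perm := distributed.perm_recordsOf zs_perm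
    obtain ⟨g, w, loop_runs, hg⟩ := exists_runs_forEach (f := emptyDown P h) (k := P.k)
      (pk := P.M + 6 * P.B) (by omega) cs fun c hc =>
        ih (distributed.receiving children zs_sorted c hc)
          (nodup_of_mem_childRecords (cs_perm.nodup_iff.2 hnd) hc)
    refine ⟨⟨c.contents.emptiedWith cs g⟩, 2 + P.l + 2 * List.length c.contents.body +
      c.contents.buf.length + wd + (cs.map w).sum, ?_,
      drained_emptiedWith hc distributed hg, rfl, .inl rfl,
      (childRecords_map_perm fun c hc => (hg c hc).records_perm).trans cs_perm,
      credit_emptiedWith_le hP (hwt h) hc (not_lt.1 hsize) distributed zs_perm wd_le hg⟩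
    have reads : P.k * P.l + 2 * List.length c.contents.body + c.contents.buf.length + 2 +
        P.k * (cs.map w).sum ≤ P.k * (2 + P.l + 2 * List.length c.contents.body +
          c.contents.buf.length + wd + (cs.map w).sum) := by
      nlinarith
    exact Runs.mono ((runs_load_node c).bind (Runs.ite_neg hsize (sort_runs.bind
      (distribute_runs.bind (runs_save.bind (loop_runs.bind
        (runs_restore.bind (runs_store_node _))))))))

end FirstPhase

/-! ### Splitting -/

section Parts

variable {α : Type u}

theorem parts_one (xs : List α) : parts 1 xs = [xs] := by
  simp [parts]

theorem length_parts (t : ℕ) (xs : List α) : (parts t xs).length = t := by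
  induction t generalizing xs with
  | zero => rfl
  | succ t ih => rw [parts, List.length_cons, ih]

theorem flatten_parts {t : ℕ} (ht : 0 < t) (xs : List α) : (parts t xs).flatten = xs := by
  induction t, ht using Nat.le_induction generalizing xs with
  | base => simp [parts_one]
  | succ t _ ih => rw [parts, List.flatten_cons, ih, List.take_append_drop]

theorem le_length_of_mem_parts {a t : ℕ} {xs g : List α} (ha : a * t ≤ xs.length)
    (hg : g ∈ parts t xs) : a ≤ g.length := by
  induction t generalizing xs with
  | zero => simp [parts] at hg
  | succ t ih =>
    have quotient_mul := Nat.div_mul_le_self xs.length (t + 1)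
    have le_quotient : a ≤ xs.length / (t + 1) := (Nat.le_div_iff_mul_le t.succ_pos).2 ha
    rcases List.mem_cons.1 hg with rfl | hg
    · rw [List.length_take]
      exact le_min le_quotient (le_quotient.trans (Nat.div_le_self _ _))
    · refine ih ?_ hg
      have := Nat.mul_le_mul_right t le_quotient
      rw [List.length_drop]
      rw [Nat.mul_succ] at quotient_mul
      omega

theorem length_le_of_mem_parts {b t : ℕ} {xs g : List α} (hb : xs.length ≤ b * t)
    (hg : g ∈ parts t xs) : g.length ≤ b := by
  induction t generalizing xs with
  | zero => simp [parts] at hg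
  | succ t ih =>
    have lt_mul : xs.length < (t + 1) * (xs.length / (t + 1) + 1) :=
      Nat.lt_mul_div_succ _ t.succ_pos
    have quotient_le : xs.length / (t + 1) ≤ b :=
      Nat.div_le_of_le_mul (by rwa [mul_comm])
    rcases List.mem_cons.1 hg with rfl | hg
    · exact (List.length_take_le _ _).trans quotient_le
    · refine ih ?_ hg
      rw [List.length_drop]
      rw [Nat.mul_succ] at hb
      rcases quotient_le.eq_or_lt with quotient_eq | quotient_lt
      · rw [quotient_eq]
        omega
      · have : (xs.length / (t + 1) + 1) * t ≤ b * t := Nat.mul_le_mul_right t quotient_lt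
        rw [Nat.succ_mul, mul_comm t] at lt_mul
        omega

theorem length_le_of_mem_parts_ceilDiv {l : ℕ} {xs g : List α} (hl : 0 < l)
    (hg : g ∈ parts (xs.length ⌈/⌉ l) xs) : g.length ≤ l :=
  length_le_of_mem_parts (le_smul_ceilDiv hl) hg

theorem half_mul_ceilDiv_le {l m : ℕ} (hm : l ≤ m) : l / 2 * (m ⌈/⌉ l) ≤ m := by
  rcases l.eq_zero_or_pos with rfl | hl
  · simp
  have ceilDiv_mul := Nat.div_mul_le_self (m + l - 1) l
  rw [← Nat.ceilDiv_eq_add_pred_div] at ceilDiv_mul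
  have half_mul : 2 * (l / 2 * (m ⌈/⌉ l)) ≤ m ⌈/⌉ l * l := by
    rw [← mul_assoc, mul_comm (m ⌈/⌉ l)]
    exact Nat.mul_le_mul_right _ (Nat.mul_div_le l 2)
  omega

theorem half_le_length_of_mem_parts_ceilDiv {l : ℕ} {xs g : List α} (hxs : l ≤ xs.length)
    (hg : g ∈ parts (xs.length ⌈/⌉ l) xs) : l / 2 ≤ g.length :=
  le_length_of_mem_parts (half_mul_ceilDiv_le hxs) hg

theorem ceilDiv_le_one_add {l m e : ℕ} (hl : 0 < l) (hm : m ≤ l + e) : m ⌈/⌉ l ≤ 1 + e := by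
  rw [ceilDiv_le_iff_le_smul hl, smul_eq_mul, mul_add, mul_one]
  exact hm.trans (Nat.add_le_add_left (Nat.le_mul_of_pos_left e hl) l)

theorem ceilDiv_pos_of_pos {l m : ℕ} (hl : 0 < l) (hm : 0 < m) : 0 < m ⌈/⌉ l := by
  by_contra! nonpos
  simpa using hm.trans_le ((ceilDiv_le_iff_le_smul hl).1 nonpos)

theorem ceilDiv_le_self {l m : ℕ} (hl : 0 < l) : m ⌈/⌉ l ≤ m :=
  (ceilDiv_le_iff_le_smul hl).2 (Nat.le_mul_of_pos_left m hl)

theorem ceilDiv_sub_one_mul_lt {l m : ℕ} (hl : 0 < l) (hm : 0 < m) : (m ⌈/⌉ l - 1) * l < m := by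
  by_contra! hle
  have ceilDiv_le : m ⌈/⌉ l ≤ m ⌈/⌉ l - 1 :=
    (ceilDiv_le_iff_le_smul hl).2 (hle.trans_eq (mul_comm _ _))
  have := ceilDiv_pos_of_pos hl hm
  omega

theorem flatten_parts_ceilDiv {l : ℕ} {xs : List α} (hl : 0 < l) (hxs : xs ≠ []) :
    (parts (xs.length ⌈/⌉ l) xs).flatten = xs :=
  flatten_parts (ceilDiv_pos_of_pos hl (List.length_pos_iff.2 hxs)) xs

theorem parts_ceilDiv_of_length_le {l : ℕ} {xs : List α} (hxs : xs ≠ []) (hl : xs.length ≤ l) :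
    parts (xs.length ⌈/⌉ l) xs = [xs] := by
  have length_pos := List.length_pos_iff.2 hxs
  have hl_pos : 0 < l := length_pos.trans_le hl
  have le_one : xs.length ⌈/⌉ l ≤ 1 := (ceilDiv_le_iff_le_smul hl_pos).2 (by simpa using hl)
  rw [le_one.antisymm (ceilDiv_pos_of_pos hl_pos length_pos), parts_one]

end Parts

section CutNodes

variable {K α : Type u} {key : α → WithTop K} {u : WithTop K}

/-- The key of the last entry of a list of cells, or `u` for the empty list. -/
def endKey (key : α → WithTop K) (u : WithTop K) (g : List (Stored α)) : WithTop K :=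
  g.getLast?.elim u fun c => key c.contents

theorem endKey_cons (c : Stored α) (g : List (Stored α)) :
    endKey key u (c :: g) = endKey key (key c.contents) g := by
  simp only [endKey, List.getLast?_cons]
  cases g.getLast? <;> rfl

theorem endKey_eq {g : List (Stored α)} {z : Stored α} (hz : z ∈ g.getLast?) :
    endKey key u g = key z.contents := by
  rw [endKey, hz, Option.elim_some]

theorem runs_copy [Footprint α] (key : α → WithTop K) (u : WithTop K) (g : List (Stored α)) {b : ℕ}
    (hb : ∀ c ∈ g, Footprint.words c.contents ≤ b) :
    Runs (copy key u g) (endKey key u g, g) g.length g.length 0 b := by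
  induction g generalizing u with
  | nil => exact (Runs.pure _).mono
  | cons c g ih =>
    have hc := hb c List.mem_cons_self
    rw [endKey_cons, List.length_cons]
    exact Runs.mono ((runs_load c).bind ((runs_store _).bind
      ((ih (key c.contents) fun d hd => hb d (List.mem_cons_of_mem _ hd)).bind (Runs.pure _))))

/-- The nodes with the given lists of entries; each is bounded by its last key, the last one
by `u`. -/
def cutNodes (key : α → WithTop K) (u : WithTop K) :
    List (List (Stored α)) → List (Stored (Node K (List (Stored α))))
  | [] => []
  | [g] => [⟨⟨u, [], 0, false, g⟩⟩]
  | g :: gs => ⟨⟨endKey key ⊤ g, [], 0, false, g⟩⟩ :: cutNodes key u gs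

theorem runs_makeNodes [Footprint α] (key : α → WithTop K) (u : WithTop K) {b : ℕ} (hb : 1 ≤ b) :
    ∀ gs : List (List (Stored α)), (∀ c ∈ gs.flatten, Footprint.words c.contents ≤ b) →
      Runs (makeNodes key u gs) (cutNodes key u gs) gs.flatten.length
        (gs.flatten.length + gs.length) 0 b
  | [], _ => (Runs.pure _).mono
  | [g], hgs => by
    rw [List.flatten_singleton] at hgs ⊢
    rw [List.length_singleton]
    exact Runs.mono ((runs_copy key ⊤ g hgs).bind
      ((runs_occupy 1).bind ((runs_store_node _).bind (Runs.pure _))))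
  | g :: g' :: gs, hgs => by
    rw [List.flatten_cons] at hgs ⊢
    have copy_runs := runs_copy key ⊤ g fun c hc => hgs c (List.mem_append_left _ hc)
    have rest_runs := runs_makeNodes key u hb (g' :: gs) fun c hc =>
      hgs c (List.mem_append_right _ hc)
    rw [List.length_append, List.length_cons (a := g)]
    exact Runs.mono (copy_runs.bind ((runs_occupy 1).bind
      ((runs_store_node _).bind (rest_runs.bind (Runs.pure _)))))

theorem map_body_cutNodes {β : Type*} (f : List (Stored α) → β) : ∀ gs : List (List (Stored α)),
    (cutNodes key u gs).map (fun r => f r.contents.body) = gs.map f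
  | [] => rfl
  | [_] => rfl
  | g :: g' :: gs => congrArg (f g :: ·) (map_body_cutNodes f (g' :: gs))

theorem body_mem_of_mem_cutNodes {gs : List (List (Stored α))}
    {r : Stored (Node K (List (Stored α)))} (hr : r ∈ cutNodes key u gs) :
    r.contents.body ∈ gs := by
  have mem_map : r.contents.body ∈ (cutNodes key u gs).map fun r => id r.contents.body :=
    List.mem_map_of_mem hr
  rwa [map_body_cutNodes, List.map_id] at mem_map

/-- A node as it comes out of a split. -/
structure Node.Fresh {σ : Type u} (v : Node K σ) : Prop where
  buf_eq : v.buf = []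
  size_eq : v.size = 0
  emptied_eq : v.emptied = false

theorem fresh_of_mem_cutNodes : ∀ {gs : List (List (Stored α))}, ∀ r ∈ cutNodes key u gs,
    r.contents.Fresh
  | [], _, hr => (List.not_mem_nil hr).elim
  | [_], _, hr => List.mem_singleton.1 hr ▸ ⟨rfl, rfl, rfl⟩
  | _ :: _ :: _, r, hr => (List.mem_cons.1 hr).elim (fun hr => hr ▸ ⟨rfl, rfl, rfl⟩)
      (fresh_of_mem_cutNodes r)

theorem upper_of_mem_cutNodes : ∀ {gs : List (List (Stored α))}, ∀ r ∈ cutNodes key u gs,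
    r.contents.upper = endKey key ⊤ r.contents.body ∨
      r.contents.upper = u ∧ r.contents.body ∈ gs.getLast?
  | [], _, hr => (List.not_mem_nil hr).elim
  | [_], _, hr => .inr (List.mem_singleton.1 hr ▸ ⟨rfl, rfl⟩)
  | _ :: g' :: gs, r, hr => (List.mem_cons.1 hr).elim (fun hr => .inl (hr ▸ rfl))
      fun hr => (upper_of_mem_cutNodes r hr).imp_right fun h => ⟨h.1, by simpa using h.2⟩

theorem upper_getLast?_cutNodes : ∀ {gs : List (List (Stored α))},
    ∀ r ∈ (cutNodes key u gs).getLast?, r.contents.upper = u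
  | [], _, hr => by simp [cutNodes] at hr
  | [_], _, hr => by
    obtain rfl : _ = _ := Option.some.inj hr
    rfl
  | g :: g' :: gs, r, hr => by
    have rest_ne_nil : cutNodes key u (g' :: gs) ≠ [] := by cases gs <;> simp [cutNodes]
    rw [cutNodes, ← List.singleton_append, List.getLast?_append_of_ne_nil _ rest_ne_nil] at hr
    · exact upper_getLast?_cutNodes r hr
    · simp

theorem key_getLast?_of_mem_cutNodes {gs : List (List (Stored α))}
    (last_key : ∀ a ∈ gs.flatten.getLast?, key a.contents = u)
    {r : Stored (Node K (List (Stored α)))} (hr : r ∈ cutNodes key u gs) {a : Stored α}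
    (ha : a ∈ r.contents.body.getLast?) : key a.contents = r.contents.upper := by
  rcases upper_of_mem_cutNodes r hr with upper_eq | ⟨upper_eq, last⟩
  · rw [upper_eq, endKey_eq ha]
  · obtain ⟨gs', rfl⟩ := List.getLast?_eq_some_iff.1 last
    rw [upper_eq]
    refine last_key a ?_
    rw [List.flatten_append, List.flatten_singleton, List.getLast?_append, ha]
    rfl

variable [LinearOrder K] {records : α → List K}

/-- The key of each entry separates it from the keys and the records of the later entries. This is
`Separated` for the entries of any kind of node. -/
def KeySeparated (key : α → WithTop K) (records : α → List K) (items : List (Stored α)) : Prop :=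
  items.Pairwise fun a b => key a.contents < key b.contents ∧
    ∀ x ∈ records b.contents, key a.contents < (x : WithTop K)

theorem KeySeparated.key_le_getLast? {items : List (Stored α)}
    (sep : KeySeparated key records items) {a z : Stored α} (ha : a ∈ items)
    (hz : z ∈ items.getLast?) : key a.contents ≤ key z.contents := by
  obtain ⟨init, rfl⟩ := List.getLast?_eq_some_iff.1 hz
  rcases List.mem_append.1 ha with ha | ha
  · exact ((List.pairwise_append.1 sep).2.2 a ha z (List.mem_singleton_self z)).1.le
  · rw [List.mem_singleton.1 ha]

theorem KeySeparated.of_mem_flatten {gs : List (List (Stored α))} {g : List (Stored α)}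
    (sep : KeySeparated key records gs.flatten) (hg : g ∈ gs) : KeySeparated key records g :=
  List.Pairwise.sublist (List.sublist_flatten_of_mem hg) sep

theorem key_le_upper_of_mem_cutNodes {gs : List (List (Stored α))}
    (sep : KeySeparated key records gs.flatten) (hu : ∀ a ∈ gs.flatten, key a.contents ≤ u)
    {r : Stored (Node K (List (Stored α)))} (hr : r ∈ cutNodes key u gs) {a : Stored α}
    (ha : a ∈ r.contents.body) : key a.contents ≤ r.contents.upper := by
  have body_mem := body_mem_of_mem_cutNodes hr
  rcases upper_of_mem_cutNodes r hr with upper_eq | ⟨upper_eq, -⟩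
  · have last := List.getLast?_eq_some_getLast (List.ne_nil_of_mem ha)
    rw [upper_eq, endKey_eq last]
    exact (sep.of_mem_flatten body_mem).key_le_getLast? ha last
  · rw [upper_eq]
    exact hu a (List.mem_flatten_of_mem body_mem ha)

theorem keySeparated_cutNodes : ∀ {gs : List (List (Stored α))}, (∀ g ∈ gs, g ≠ []) →
    KeySeparated key records gs.flatten → (∀ a ∈ gs.flatten, key a.contents ≤ u) →
    KeySeparated Node.upper (fun v => (v.body.map fun a => records a.contents).flatten)
      (cutNodes key u gs)
  | [], _, _, _ => List.Pairwise.nil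
  | [_], _, _, _ => List.pairwise_singleton _ _
  | g :: g' :: gs, hne, sep, hu => by
    rw [List.flatten_cons] at sep hu
    obtain ⟨-, sep_rest, sep_cross⟩ := List.pairwise_append.1 sep
    have hu_rest := fun a ha => hu a (List.mem_append_right g ha)
    have hne_rest := fun x hx => hne x (List.mem_cons_of_mem g hx)
    have last := List.getLast?_eq_some_getLast (hne g List.mem_cons_self)
    have last_mem := List.getLast_mem (hne g List.mem_cons_self)
    refine List.pairwise_cons.2 ⟨fun r hr => ?_, keySeparated_cutNodes hne_rest sep_rest hu_rest⟩
    have body_mem := body_mem_of_mem_cutNodes hr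
    simp only [endKey_eq last]
    constructor
    · obtain ⟨a, ha⟩ := List.exists_mem_of_ne_nil _ (hne_rest _ body_mem)
      exact (sep_cross _ last_mem a (List.mem_flatten_of_mem body_mem ha)).1.trans_le
        (key_le_upper_of_mem_cutNodes sep_rest hu_rest hr ha)
    · intro x hx
      obtain ⟨xs, hxs, hx⟩ := List.mem_flatten.1 hx
      obtain ⟨a, ha, rfl⟩ := List.mem_map.1 hxs
      exact (sep_cross _ last_mem a (List.mem_flatten_of_mem body_mem ha)).2 x hx

end CutNodes

section CutTrees

variable {K : Type u} {h : ℕ} {u : WithTop K}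

theorem Node.Fresh.recordsOf_zero {v : Tree K 0} (hv : v.Fresh) :
    recordsOf 0 v = contentsOf v.body := by
  rw [AEM.recordsOf_zero, hv.buf_eq, contentsOf_nil, List.nil_append]

theorem Node.Fresh.recordsOf_succ {v : Tree K (h + 1)} (hv : v.Fresh) :
    recordsOf (h + 1) v = childRecords h v.body := by
  rw [AEM.recordsOf_succ, hv.buf_eq, contentsOf_nil, List.nil_append]

theorem childRecords_flatten (gs : List (List (Stored (Tree K h)))) :
    childRecords h gs.flatten = (gs.map (childRecords h)).flatten := by
  induction gs with
  | nil => rfl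
  | cons g gs ih => rw [List.flatten_cons, childRecords_append, ih, List.map_cons,
      List.flatten_cons]

theorem childRecords_cutNodes_upper {gs : List (List (Stored (Tree K h)))} :
    childRecords (h + 1) (cutNodes Node.upper u gs) = childRecords h gs.flatten := by
  rw [childRecords_flatten, ← map_body_cutNodes (key := Node.upper) (u := u), childRecords]
  exact congrArg List.flatten
    (List.map_congr_left fun r hr => (fresh_of_mem_cutNodes r hr).recordsOf_succ)

theorem sum_credit_cutNodes_upper {gs : List (List (Stored (Tree K h)))} (wt : ℕ → ℕ) (e : ℕ) :
    ((cutNodes Node.upper u gs).map fun r => credit wt e (h + 1) r.contents).sum =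
      (gs.flatten.map fun c => credit wt e h c.contents).sum := by
  rw [List.map_flatten, List.sum_flatten, List.map_map,
    ← map_body_cutNodes (key := Node.upper) (u := u)]
  refine congrArg List.sum (List.map_congr_left fun r hr => ?_)
  have fresh := fresh_of_mem_cutNodes r hr
  simp [credit, fresh.buf_eq, fresh.emptied_eq]

theorem childRecords_cutNodes_lastKey {gs : List (List (Block K))} :
    childRecords 0 (cutNodes lastKey u gs) = contentsOf gs.flatten := by
  rw [contentsOf_flatten, ← map_body_cutNodes (key := lastKey) (u := u), childRecords]
  exact congrArg List.flatten
    (List.map_congr_left fun r hr => (fresh_of_mem_cutNodes r hr).recordsOf_zero)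

theorem sum_credit_cutNodes_lastKey {gs : List (List (Block K))} (wt : ℕ → ℕ) (e : ℕ) :
    ((cutNodes lastKey u gs).map fun r => credit wt e 0 r.contents).sum = 0 := by
  rw [List.sum_eq_zero_iff]
  intro n hn
  obtain ⟨r, hr, rfl⟩ := List.mem_map.1 hn
  simp [credit, (fresh_of_mem_cutNodes r hr).buf_eq]

theorem exists_lastKey_eq {xs : List K} (hxs : xs ≠ []) :
    ∃ y ∈ xs, lastKey xs = (y : WithTop K) :=
  ⟨xs.getLast hxs, List.getLast_mem hxs, by rw [lastKey, List.getLast?_eq_some_getLast hxs]; rfl⟩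

end CutTrees

section Balanced

variable {K : Type u} [LinearOrder K] {l B h : ℕ} {isRoot : Bool} {u : WithTop K}

/-- A list of nodes that may take the place of a node with bound `u`. -/
structure Balanced (l B h : ℕ) (isRoot : Bool) (u : WithTop K) (rs : List (Stored (Tree K h))) :
    Prop where
  ne_nil : rs ≠ []
  nodeOK : (∀ r ∈ rs, NodeOK l B h false r.contents) ∨
    (isRoot = true ∧ ∃ r, rs = [r] ∧ NodeOK l B h true r.contents)
  separated : Separated h rs
  last_upper : ∀ r ∈ rs.getLast?, r.contents.upper = u

theorem NodeOK.balanced {c : Stored (Tree K h)} (hc : NodeOK l B h isRoot c.contents) :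
    Balanced l B h isRoot c.contents.upper [c] where
  ne_nil := List.cons_ne_nil _ _
  nodeOK := by
    cases isRoot with
    | false => exact .inl (by simpa using hc)
    | true => exact .inr ⟨rfl, c, rfl, hc⟩
  separated := List.pairwise_singleton _ _
  last_upper := by simp

theorem Node.Fresh.nodeOK {v : Tree K h} (hv : v.Fresh) (hlB : 0 < l * B)
    (le_upper : ∀ x ∈ recordsOf h v, (x : WithTop K) ≤ v.upper)
    (bodyOK : BodyOK l B h isRoot v) : NodeOK l B h isRoot v :=
  nodeOK_iff.2 ⟨⟨⟨hv.buf_eq ▸ dense_nil B, by rw [hv.size_eq, hv.buf_eq]; rfl,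
    by simp [hv.buf_eq]⟩, le_upper, bodyOK⟩, hv.size_eq ▸ hlB⟩

theorem Separated.upper_le {cs : List (Stored (Tree K h))} (sep : Separated h cs)
    (last_upper : ∀ c ∈ cs.getLast?, c.contents.upper = u) {c : Stored (Tree K h)} (hc : c ∈ cs) :
    c.contents.upper ≤ u := by
  have last := List.getLast?_eq_some_getLast (List.ne_nil_of_mem hc)
  exact last_upper _ last ▸ KeySeparated.key_le_getLast? (key := Node.upper) sep hc last

section Internal

variable {gs : List (List (Stored (Tree K h)))}

theorem nodeOK_of_mem_cutNodes_upper (hlB : 0 < l * B)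
    (ok : ∀ c ∈ gs.flatten, NodeOK l B h false c.contents) (sep : Separated h gs.flatten)
    (last_upper : ∀ c ∈ gs.flatten.getLast?, c.contents.upper = u)
    (two_le : ∀ g ∈ gs, 2 ≤ g.length) (length_le : ∀ g ∈ gs, g.length ≤ l)
    (le_length : isRoot = false → ∀ g ∈ gs, l ≤ 4 * g.length) {r : Stored (Tree K (h + 1))}
    (hr : r ∈ cutNodes Node.upper u gs) : NodeOK l B (h + 1) isRoot r.contents := by
  have fresh := fresh_of_mem_cutNodes r hr
  have body_mem := body_mem_of_mem_cutNodes hr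
  refine fresh.nodeOK hlB (fun x hx => ?_) ⟨fresh.emptied_eq,
    ⟨length_le _ body_mem, two_le _ body_mem, fun root => le_length root _ body_mem,
      KeySeparated.of_mem_flatten (key := Node.upper) sep body_mem,
      fun c hc => key_getLast?_of_mem_cutNodes last_upper hr hc⟩,
    fun c hc => ok c (List.mem_flatten_of_mem body_mem hc)⟩
  rw [fresh.recordsOf_succ] at hx
  obtain ⟨c, hc, hx⟩ := mem_childRecords.1 hx
  exact ((ok c (List.mem_flatten_of_mem body_mem hc)).receiving.le_upper x hx).trans
    (key_le_upper_of_mem_cutNodes sep (fun _ => sep.upper_le last_upper) hr hc)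

theorem separated_cutNodes_upper (sep : Separated h gs.flatten)
    (last_upper : ∀ c ∈ gs.flatten.getLast?, c.contents.upper = u) (hne : ∀ g ∈ gs, g ≠ []) :
    Separated (h + 1) (cutNodes Node.upper u gs) :=
  (keySeparated_cutNodes hne sep fun _ => sep.upper_le last_upper).imp_of_mem
    fun _ hs rs => ⟨rs.1, (fresh_of_mem_cutNodes _ hs).recordsOf_succ ▸ rs.2⟩

end Internal

section Leaf

theorem le_lastKey {xs : List K} (sorted : xs.Pairwise (· < ·)) {x : K} (hx : x ∈ xs) :
    (x : WithTop K) ≤ lastKey xs := by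
  rw [lastKey, List.getLast?_eq_some_getLast (List.ne_nil_of_mem hx)]
  exact WithTop.coe_le_coe.2 ((sorted.imp le_of_lt).rel_getLast hx)

theorem sorted_of_mem {bs : List (Block K)} (sorted : (contentsOf bs).Pairwise (· < ·))
    {b : Block K} (hb : b ∈ bs) : b.contents.Pairwise (· < ·) :=
  (List.pairwise_flatten.1 sorted).1 _ (List.mem_map_of_mem hb)

theorem keySeparated_lastKey {bs : List (Block K)} (dense : Dense B bs)
    (sorted : (contentsOf bs).Pairwise (· < ·)) : KeySeparated lastKey id bs := by
  refine (List.pairwise_map.1 (List.pairwise_flatten.1 sorted).2).imp_of_mem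
    fun {a b} ha hb hab => ?_
  obtain ⟨y, hy, last_a⟩ := exists_lastKey_eq (dense.ne_nil_of_mem ha)
  obtain ⟨z, hz, last_b⟩ := exists_lastKey_eq (dense.ne_nil_of_mem hb)
  rw [last_a, last_b]
  exact ⟨WithTop.coe_lt_coe.2 (hab y hy z hz), fun x hx => WithTop.coe_lt_coe.2 (hab y hy x hx)⟩

theorem lastKey_le {bs : List (Block K)} (dense : Dense B bs)
    (le_u : ∀ x ∈ contentsOf bs, (x : WithTop K) ≤ u) : ∀ b ∈ bs, lastKey b.contents ≤ u := by
  intro b hb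
  obtain ⟨y, hy, last⟩ := exists_lastKey_eq (dense.ne_nil_of_mem hb)
  exact last ▸ le_u y (mem_contentsOf.2 ⟨b, hb, hy⟩)

variable {gs : List (List (Block K))}

theorem nodeOK_of_mem_cutNodes_lastKey (hl : 8 ≤ l) (hB : 0 < B) (dense : Dense B gs.flatten)
    (sorted : (contentsOf gs.flatten).Pairwise (· < ·))
    (le_u : ∀ x ∈ contentsOf gs.flatten, (x : WithTop K) ≤ u)
    (half_le : ∀ g ∈ gs, l / 2 ≤ g.length) (length_le : ∀ g ∈ gs, g.length ≤ l)
    {r : Stored (Tree K 0)} (hr : r ∈ cutNodes lastKey u gs) :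
    NodeOK l B 0 isRoot r.contents := by
  have fresh := fresh_of_mem_cutNodes r hr
  have body_mem := body_mem_of_mem_cutNodes hr
  obtain ⟨as, bs, flatten_eq⟩ := List.infix_of_mem_flatten body_mem
  have body_dense : Dense B r.contents.body :=
    (flatten_eq ▸ dense).of_append_left.of_append_right
  have body_ne_nil : r.contents.body ≠ [] := by
    rintro body_eq
    have := half_le _ body_mem
    simp only [body_eq, List.length_nil] at this
    omega
  have le_records : l * B ≤ 4 * (contentsOf r.contents.body).length := by
    have records := body_dense.length_mul_lt body_ne_nil
    have half_mul := Nat.mul_le_mul_right B (half_le _ body_mem)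
    have quarter_mul : l * B ≤ (4 * (l / 2) - 4) * B := Nat.mul_le_mul_right _ (by omega)
    rw [Nat.sub_mul, mul_assoc] at quarter_mul
    omega
  refine fresh.nodeOK (Nat.mul_pos (by omega) hB) (fun x hx => ?_)
    ⟨body_dense, ?_, length_le _ body_mem, body_dense.length_contentsOf_le.trans
      (Nat.mul_le_mul_right _ (length_le _ body_mem)), fun _ => le_records⟩
  · rw [fresh.recordsOf_zero] at hx
    obtain ⟨b, hb, hx⟩ := mem_contentsOf.1 hx
    exact (le_lastKey (sorted_of_mem sorted (List.mem_flatten_of_mem body_mem hb)) hx).trans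
      (key_le_upper_of_mem_cutNodes (keySeparated_lastKey dense sorted) (lastKey_le dense le_u)
        hr hb)
  · rw [contentsOf_flatten] at sorted
    exact (List.pairwise_flatten.1 sorted).1 _ (List.mem_map_of_mem body_mem)

theorem separated_cutNodes_lastKey (dense : Dense B gs.flatten)
    (sorted : (contentsOf gs.flatten).Pairwise (· < ·))
    (le_u : ∀ x ∈ contentsOf gs.flatten, (x : WithTop K) ≤ u) (hne : ∀ g ∈ gs, g ≠ []) :
    Separated 0 (cutNodes lastKey u gs) :=
  (keySeparated_cutNodes hne (keySeparated_lastKey dense sorted)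
    (lastKey_le dense le_u)).imp_of_mem
      fun _ hs rs => ⟨rs.1, (fresh_of_mem_cutNodes _ hs).recordsOf_zero ▸ rs.2⟩

end Leaf

end Balanced

section Split

variable {K α : Type u} {key : α → WithTop K} {u : WithTop K} {l : ℕ}

/-- The nodes that `split` makes from a list of entries. -/
def splitResult (l : ℕ) (key : α → WithTop K) (u : WithTop K) (items : List (Stored α)) :
    List (Stored (Node K (List (Stored α)))) :=
  cutNodes key u (parts (items.length ⌈/⌉ l) items)

theorem runs_split [Footprint α] {P : Params} (hl : 0 < P.l) (key : α → WithTop K) (u : WithTop K)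
    {items : List (Stored α)} (hne : items ≠ []) {b : ℕ} (hb : 1 ≤ b)
    (words_le : ∀ c ∈ items, Footprint.words c.contents ≤ b) :
    Runs (split P key u items) (splitResult P.l key u items) items.length
      (items.length + items.length ⌈/⌉ P.l) 0 b := by
  have flatten_eq := flatten_parts_ceilDiv hl hne
  have runs := runs_makeNodes key u hb (parts (items.length ⌈/⌉ P.l) items)
    (by rwa [flatten_eq])
  rwa [flatten_eq, length_parts] at runs

theorem length_splitResult (l : ℕ) (key : α → WithTop K) (u : WithTop K)
    (items : List (Stored α)) :
    (splitResult l key u items).length = items.length ⌈/⌉ l := by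
  have length_eq := congrArg List.length (map_body_cutNodes (key := key) (u := u) id
    (parts (items.length ⌈/⌉ l) items))
  rwa [List.length_map, List.length_map, length_parts] at length_eq

theorem buf_eq_nil_of_mem_splitResult {items : List (Stored α)} {r : Stored (Node K _)}
    (hr : r ∈ splitResult l key u items) : r.contents.buf = [] :=
  (fresh_of_mem_cutNodes r hr).buf_eq

variable {h : ℕ}

theorem childRecords_splitResult_upper (hl : 0 < l) {cs : List (Stored (Tree K h))}
    (hcs : cs ≠ []) :
    childRecords (h + 1) (splitResult l Node.upper u cs) = childRecords h cs := by
  rw [splitResult, childRecords_cutNodes_upper, flatten_parts_ceilDiv hl hcs]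

theorem childRecords_splitResult_lastKey (hl : 0 < l) {bs : List (Block K)} (hbs : bs ≠ []) :
    childRecords 0 (splitResult l lastKey u bs) = contentsOf bs := by
  rw [splitResult, childRecords_cutNodes_lastKey, flatten_parts_ceilDiv hl hbs]

theorem sum_credit_splitResult_upper (wt : ℕ → ℕ) (e : ℕ) (hl : 0 < l)
    {cs : List (Stored (Tree K h))} (hcs : cs ≠ []) :
    ((splitResult l Node.upper u cs).map fun r => credit wt e (h + 1) r.contents).sum =
      (cs.map fun c => credit wt e h c.contents).sum := by
  rw [splitResult, sum_credit_cutNodes_upper, flatten_parts_ceilDiv hl hcs]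

variable [LinearOrder K] {B : ℕ} {isRoot : Bool}

theorem balanced_splitResult_upper (hl : 8 ≤ l) (hB : 0 < B) {cs : List (Stored (Tree K h))}
    (ok : ∀ c ∈ cs, NodeOK l B h false c.contents) (sep : Separated h cs)
    (last_upper : ∀ c ∈ cs.getLast?, c.contents.upper = u) (two_le : 2 ≤ cs.length)
    (le_length : isRoot = false → l ≤ 4 * cs.length) :
    Balanced l B (h + 1) isRoot u (splitResult l Node.upper u cs) := by
  have hl_pos : 0 < l := by omega
  have hlB : 0 < l * B := Nat.mul_pos hl_pos hB
  have hcs : cs ≠ [] := List.ne_nil_of_length_pos (by omega)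
  have flatten_eq := flatten_parts_ceilDiv hl_pos hcs
  have singleton (hlt : cs.length < l) := parts_ceilDiv_of_length_le hcs hlt.le
  have half_le (hle : ¬cs.length < l) := fun g (hg : g ∈ parts (cs.length ⌈/⌉ l) cs) =>
    half_le_length_of_mem_parts_ceilDiv (not_lt.1 hle) hg
  have parts_two_le : ∀ g ∈ parts (cs.length ⌈/⌉ l) cs, 2 ≤ g.length := fun g hg => by
    by_cases hlt : cs.length < l
    · rw [singleton hlt, List.mem_singleton] at hg
      exact hg ▸ two_le
    · have := half_le hlt g hg
      omega
  rw [← flatten_eq] at ok sep last_upper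
  have node_ok (b : Bool) (h_b : b = false → ∀ g ∈ parts (cs.length ⌈/⌉ l) cs, l ≤ 4 * g.length)
      (r : Stored (Tree K (h + 1))) (hr : r ∈ splitResult l Node.upper u cs) :
      NodeOK l B (h + 1) b r.contents :=
    nodeOK_of_mem_cutNodes_upper hlB ok sep last_upper parts_two_le
      (fun _ => length_le_of_mem_parts_ceilDiv hl_pos) h_b hr
  refine ⟨List.ne_nil_of_length_pos ?_, ?_, separated_cutNodes_upper sep last_upper fun g hg =>
    List.ne_nil_of_length_pos (two_pos.trans_le (parts_two_le g hg)), upper_getLast?_cutNodes⟩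
  · rw [length_splitResult]
    exact ceilDiv_pos_of_pos hl_pos (by omega)
  by_cases hlt : cs.length < l
  · cases isRoot with
    | false => exact .inl (node_ok false fun _ => by simpa [singleton hlt] using le_length)
    | true =>
      have eq_singleton : splitResult l Node.upper u cs = [⟨⟨u, [], 0, false, cs⟩⟩] := by
        rw [splitResult, singleton hlt, cutNodes]
      exact .inr ⟨rfl, _, eq_singleton, node_ok true nofun _ (by simp [eq_singleton])⟩
  · refine .inl (node_ok false fun _ g hg => ?_)
    have := half_le hlt g hg
    omega

theorem balanced_splitResult_lastKey (hl : 8 ≤ l) (hB : 0 < B) {bs : List (Block K)}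
    (dense : Dense B bs) (sorted : (contentsOf bs).Pairwise (· < ·))
    (le_u : ∀ x ∈ contentsOf bs, (x : WithTop K) ≤ u)
    (le_records : l * B ≤ (contentsOf bs).length) :
    Balanced l B 0 isRoot u (splitResult l lastKey u bs) := by
  have le_length : l ≤ bs.length :=
    Nat.le_of_mul_le_mul_right (le_records.trans dense.length_contentsOf_le) hB
  have hl_pos : 0 < l := by omega
  have flatten_eq := flatten_parts_ceilDiv hl_pos (List.ne_nil_of_length_pos (by omega) : bs ≠ [])
  have half_le := fun g (hg : g ∈ parts (bs.length ⌈/⌉ l) bs) =>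
    half_le_length_of_mem_parts_ceilDiv le_length hg
  have length_le := fun g (hg : g ∈ parts (bs.length ⌈/⌉ l) bs) =>
    length_le_of_mem_parts_ceilDiv hl_pos hg
  rw [← flatten_eq] at dense sorted le_u
  refine ⟨List.ne_nil_of_length_pos ?_, .inl fun r hr => nodeOK_of_mem_cutNodes_lastKey hl hB
    dense sorted le_u half_le length_le hr, separated_cutNodes_lastKey dense sorted le_u
    fun g hg => List.ne_nil_of_length_pos ?_, upper_getLast?_cutNodes⟩
  · rw [length_splitResult]
    exact ceilDiv_pos_of_pos hl_pos (by omega)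
  · have := half_le g hg
    omega

end Split

/-! ### The second phase -/

section Flatten

variable {α β : Type u}

theorem exists_length_flatten_sum_le {g : α → List β} {w f : α → ℕ} {f' : β → ℕ} {B d : ℕ}
    (as : List α) (hne : ∀ a ∈ as, g a ≠ [])
    (h : ∀ a ∈ as, B * w a + ((g a).map f').sum + d * ((g a).length - 1) ≤ f a + B) :
    ∃ n, (as.map g).flatten.length = as.length + n ∧
      B * (as.map w).sum + ((as.map g).flatten.map f').sum + d * n ≤
        (as.map f).sum + as.length * B := by
  induction as with
  | nil => exact ⟨0, by simp⟩
  | cons a as ih =>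
    obtain ⟨ne_a, ne_as⟩ := List.forall_mem_cons.1 hne
    obtain ⟨le_a, le_as⟩ := List.forall_mem_cons.1 h
    obtain ⟨n, length_eq, sum_le⟩ := ih ne_as le_as
    have length_pos := List.length_pos_iff.2 ne_a
    refine ⟨n + ((g a).length - 1), ?_, ?_⟩
    · simp only [List.map_cons, List.flatten_cons, List.length_append, length_eq, List.length_cons]
      omega
    · simp only [List.map_cons, List.flatten_cons, List.map_append, List.sum_append, List.sum_cons,
        List.length_cons, mul_add, Nat.succ_mul]
      omega

end Flatten

section Replacements

variable {K : Type u} {h : ℕ} {cs : List (Stored (Tree K h))}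
  {g : Stored (Tree K h) → List (Stored (Tree K h))}

theorem childRecords_flatten_perm
    (hg : ∀ c ∈ cs, (childRecords h (g c)).Perm (recordsOf h c.contents)) :
    (childRecords h (cs.map g).flatten).Perm (childRecords h cs) := by
  induction cs with
  | nil => rfl
  | cons c cs ih =>
    obtain ⟨head, tail⟩ := List.forall_mem_cons.1 hg
    rw [List.map_cons, List.flatten_cons, childRecords_append]
    exact head.append (ih tail)

theorem credit_splitNode_le {P : Params} (hP : P.Valid) {wt : ℕ → ℕ} {d : ℕ}
    {v : Tree K (h + 1)} {items : List (Stored (Tree K h))}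
    {n w : ℕ} (buf_eq : v.buf = []) (emptied_eq : v.emptied = true)
    (body_le : List.length v.body ≤ P.l) (length_eq : items.length = List.length v.body + n)
    (sum_le : P.B * w + (items.map fun c => credit wt (3 * (P.l * P.B)) h c.contents).sum +
        4 * P.B * (d + 1) * n ≤
      (List.map (fun c : Stored (Tree K h) => credit wt (3 * (P.l * P.B)) h c.contents)
        v.body).sum + List.length v.body * P.B) :
    P.B * (w + 2 + items.length + items.length ⌈/⌉ P.l) +
        (items.map fun c => credit wt (3 * (P.l * P.B)) h c.contents).sum +
        4 * P.B * d * (items.length ⌈/⌉ P.l - 1) ≤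
      credit wt (3 * (P.l * P.B)) (h + 1) v + P.B := by
  have ceilDiv_le : items.length ⌈/⌉ P.l ≤ 1 + n :=
    ceilDiv_le_one_add (by have := hP.le_l; omega) (by omega)
  have body_records_le := Nat.mul_le_mul_right P.B body_le
  have new_records_le := Nat.mul_le_mul_left P.B ceilDiv_le
  have extra_le := Nat.mul_le_mul_left (4 * P.B * d) (Nat.sub_le_iff_le_add'.2 ceilDiv_le)
  have new_nonneg := Nat.zero_le (P.B * n)
  have B_le := hP.B_le
  simp only [credit, emptied_eq, buf_eq, contentsOf_nil, List.length_nil, if_true, length_eq]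
    at new_records_le extra_le ⊢
  linarith

variable [LinearOrder K] {l B : ℕ}

theorem NodeOK.exists_mem (hlB : 0 < l * B) {v : Tree K h} (hv : NodeOK l B h false v) :
    ∃ x, x ∈ recordsOf h v := by
  induction h with
  | zero =>
    have le_records := hv.receiving.bodyOK.le_records rfl
    obtain ⟨x, hx⟩ := List.exists_mem_of_length_pos (l := contentsOf v.body) (by omega)
    exact ⟨x, List.mem_append_right _ hx⟩
  | succ h ih =>
    obtain ⟨-, shape, children⟩ := hv.receiving.bodyOK
    obtain ⟨c, hc⟩ := List.exists_mem_of_length_pos (l := (v.body : List (Stored (Tree K h))))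
      (zero_lt_two.trans_le shape.two_le)
    obtain ⟨x, hx⟩ := ih (children c hc)
    exact ⟨x, List.mem_append_right _ (mem_childRecords.2 ⟨c, hc, hx⟩)⟩

theorem Balanced.forall_nodeOK {u : WithTop K} (hcs : Balanced l B h false u cs) :
    ∀ c ∈ cs, NodeOK l B h false c.contents :=
  hcs.nodeOK.resolve_right fun root => Bool.false_ne_true root.1

theorem nodeOK_of_mem_flatten
    (hg : ∀ c ∈ cs, Balanced l B h false c.contents.upper (g c)) {r : Stored (Tree K h)}
    (hr : r ∈ (cs.map g).flatten) : NodeOK l B h false r.contents := by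
  obtain ⟨_, hrs, hr⟩ := List.mem_flatten.1 hr
  obtain ⟨c, hc, rfl⟩ := List.mem_map.1 hrs
  exact (hg c hc).forall_nodeOK r hr

theorem last_upper_flatten
    (hg : ∀ c ∈ cs, Balanced l B h false c.contents.upper (g c)) {u : WithTop K}
    (last_upper : ∀ c ∈ cs.getLast?, c.contents.upper = u) :
    ∀ r ∈ (cs.map g).flatten.getLast?, r.contents.upper = u := by
  intro r hr
  rcases cs.eq_nil_or_concat' with rfl | ⟨init, z, rfl⟩
  · simp at hr
  · have hz := hg z (by simp)
    rw [List.map_append, List.flatten_append, List.map_singleton, List.flatten_singleton,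
      List.getLast?_append_of_ne_nil _ hz.ne_nil] at hr
    exact (hz.last_upper r hr).trans (last_upper z (by simp))

theorem Separated.flatten (hlB : 0 < l * B) (hcs : Separated h cs)
    (hg : ∀ c ∈ cs, Balanced l B h false c.contents.upper (g c))
    (records_perm : ∀ c ∈ cs, (childRecords h (g c)).Perm (recordsOf h c.contents)) :
    Separated h (cs.map g).flatten := by
  rw [Separated, List.pairwise_flatten, List.pairwise_map]
  refine ⟨List.forall_mem_map.2 fun c hc => (hg c hc).separated, List.Pairwise.imp_of_mem ?_ hcs⟩
  intro c d hc hd hcd r hr s hs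
  have upper_lt : ∀ x ∈ recordsOf h s.contents, r.contents.upper < (x : WithTop K) := fun x hx =>
    ((hg c hc).separated.upper_le (hg c hc).last_upper hr).trans_lt
      (hcd.2 x ((records_perm d hd).mem_iff.1 (mem_childRecords.2 ⟨s, hs, hx⟩)))
  have hs := (hg d hd).forall_nodeOK s hs
  obtain ⟨x, hx⟩ := hs.exists_mem hlB
  exact ⟨(upper_lt x hx).trans_le (hs.receiving.le_upper x hx), upper_lt⟩

end Replacements

section SecondPhase

variable {K : Type u} [LinearOrder K]

/-- What the second phase achieves at and below the node `v`, which is replaced by the nodes `rs`,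
with `w` block writes. Each node beyond the first is endowed with credit for the `d` levels at
which it may cause a split. -/
structure RebalancesTo (l B : ℕ) (wt : ℕ → ℕ) (d h : ℕ) (isRoot : Bool) (v : Tree K h)
    (rs : List (Stored (Tree K h))) (w : ℕ) : Prop where
  balanced : Balanced l B h isRoot v.upper rs
  buf_eq : ∀ r ∈ rs, r.contents.buf = [] ∨ r.contents.buf = v.buf
  records_perm : (childRecords h rs).Perm (recordsOf h v)
  credit_le : B * w + (rs.map fun r => credit wt (3 * (l * B)) h r.contents).sum +
    4 * B * d * (rs.length - 1) ≤ credit wt (3 * (l * B)) h v + B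

variable {P : Params} {wt : ℕ → ℕ} {d h : ℕ} {isRoot : Bool}

theorem NodeOK.rebalancesTo {l B : ℕ} {c : Stored (Tree K h)}
    (hc : NodeOK l B h isRoot c.contents) :
    RebalancesTo l B wt d h isRoot c.contents [c] 1 where
  balanced := hc.balanced
  buf_eq := by simp
  records_perm := by rw [childRecords_cons, childRecords_nil, List.append_nil]
  credit_le := by simp [add_comm]

theorem runs_mergeLeaf (hP : P.Valid) {v : Tree K 0} (hv : Receiving P.l P.B 0 isRoot v)
    (hfull : P.l * P.B ≤ v.size) (hnd : (recordsOf 0 v).Nodup) :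
    ∃ s o out,
      Runs (selectionSort P P.k ⊥ (v.buf.take P.l)) s (P.k * P.l) P.l 0 (P.M + P.B) ∧
      Runs (mergeFiles P v.size s (v.buf.drop P.l)) o v.buf.length o.length 0 (3 * P.B) ∧
      Runs (mergeFiles P (v.size + P.l * P.B) o v.body) out (o.length + List.length v.body)
        out.length 0 (3 * P.B) ∧
      o.length * P.B ≤ v.size + P.B ∧ Dense P.B out ∧
      (contentsOf out).Perm (recordsOf 0 v) ∧ (contentsOf out).Pairwise (· < ·) := by
  have hB := hP.one_le_B
  have size_eq := hv.bufferOK.size_eq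
  have leaf := hv.bodyOK
  obtain ⟨s, sort_runs, sorted⟩ := runs_sortBuffer hP hv.bufferOK hfull hnd.of_append_left
  have pair_length := sorted.merge_perm.length_eq
  rw [List.length_merge, ← size_eq] at pair_length
  obtain ⟨o, o_runs, o_dense, o_contents⟩ :=
    runs_mergeFiles P hB v.size sorted.left_dense sorted.right_dense pair_length.le
  rw [sorted.length_add] at o_runs
  have o_perm : (contentsOf o).Perm (contentsOf v.buf) := o_contents ▸ sorted.merge_perm
  have o_length : (contentsOf o).length = v.size := by rw [o_perm.length_eq, size_eq]
  have body_length := leaf.records_le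
  obtain ⟨out, out_runs, out_dense, out_contents⟩ :=
    runs_mergeFiles P hB (v.size + P.l * P.B) o_dense leaf.dense (by omega)
  refine ⟨s, o, out, sort_runs, o_runs, out_runs, o_length ▸ o_dense.length_mul_le, out_dense,
    ?_, ?_⟩
  · rw [out_contents]
    exact (List.merge_perm_append _).trans (o_perm.append_right _)
  · rw [out_contents]
    exact pairwise_lt_merge (o_contents ▸ sorted.merge_sorted.imp le_of_lt)
      (leaf.sorted.imp le_of_lt) ((o_perm.append_right _).nodup_iff.2 hnd)

theorem four_mul_ceilDiv_sub_one_le (hP : P.Valid) {v : Tree K 0}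
    (hv : Receiving P.l P.B 0 isRoot v) (hfull : P.l * P.B ≤ v.size) {out : List (Block K)}
    (hout : out ≠ []) (dense : Dense P.B out)
    (perm : (contentsOf out).Perm (recordsOf 0 v)) :
    4 * P.B * (out.length ⌈/⌉ P.l - 1) ≤ v.size := by
  have hl := hP.le_l
  have out_lt := dense.length_mul_lt hout
  rw [perm.length_eq, recordsOf_zero, List.length_append, ← hv.bufferOK.size_eq] at out_lt
  have body_le := hv.bodyOK.records_le
  have split_le : (out.length ⌈/⌉ P.l - 1) * P.l * P.B + P.B ≤ out.length * P.B := by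
    rw [← Nat.succ_mul]
    exact Nat.mul_le_mul_right _
      (ceilDiv_sub_one_mul_lt (by omega) (List.length_pos_iff.2 hout))
  have eight_le : (out.length ⌈/⌉ P.l - 1) * 8 * P.B ≤ (out.length ⌈/⌉ P.l - 1) * P.l * P.B :=
    Nat.mul_le_mul_right _ (Nat.mul_le_mul_left _ hl)
  linarith

theorem credit_splitLeaf_le (hP : P.Valid) (hwt : 11 + d ≤ wt 0) {v : Tree K 0}
    (hv : Receiving P.l P.B 0 isRoot v) (hfull : P.l * P.B ≤ v.size) {o out : List (Block K)}
    (ho : o.length * P.B ≤ v.size + P.B) (hout : out ≠ []) (dense : Dense P.B out)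
    (perm : (contentsOf out).Perm (recordsOf 0 v)) :
    P.B * (1 + P.l + v.buf.length + o.length + List.length v.body + 2 * out.length +
        out.length ⌈/⌉ P.l) + 4 * P.B * d * (out.length ⌈/⌉ P.l - 1) ≤
      credit wt (3 * (P.l * P.B)) 0 v + P.B := by
  have size_eq := hv.bufferOK.size_eq
  have buf_le := hv.bufferOK.dense.length_mul_le
  have out_le := dense.length_mul_le
  rw [perm.length_eq, recordsOf_zero, List.length_append, ← size_eq] at out_le
  rw [← size_eq] at buf_le
  have records_le := hv.bodyOK.records_le
  have body_le : List.length v.body * P.B ≤ P.l * P.B :=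
    Nat.mul_le_mul_right _ hv.bodyOK.length_le
  have ceilDiv_le : out.length ⌈/⌉ P.l * P.B ≤ out.length * P.B :=
    Nat.mul_le_mul_right _ (ceilDiv_le_self (by have := hP.le_l; omega))
  have extra_le := Nat.mul_le_mul_left d (four_mul_ceilDiv_sub_one_le hP hv hfull hout dense perm)
  have weight_le := Nat.mul_le_mul_right v.size hwt
  have B_le := hP.B_le
  simp only [credit, ← size_eq]
  linarith

theorem runs_rebalance_leaf (hP : P.Valid) (hwt : 11 + d ≤ wt 0) {c : Stored (Tree K 0)}
    (hc : Receiving P.l P.B 0 isRoot c.contents) (hnd : (recordsOf 0 c.contents).Nodup) :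
    ∃ rs w, Runs (rebalance P 0 c) rs (P.k * w) w 0 (P.M + 6 * P.B) ∧
      RebalancesTo P.l P.B wt d 0 isRoot c.contents rs w := by
  have hB := hP.one_le_B
  have hk := hP.one_le_k
  have hl := hP.le_l
  by_cases hsize : c.contents.size < P.l * P.B
  · exact ⟨[c], 1, Runs.mono ((runs_load_node c).bind (Runs.ite_pos hsize
      ((runs_release 1).bind (Runs.pure _)))), (nodeOK_iff.2 ⟨hc, hsize⟩).rebalancesTo⟩
  have hfull := not_lt.1 hsize
  obtain ⟨s, o, out, sort_runs, o_runs, out_runs, o_le, out_dense, out_perm, out_sorted⟩ :=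
    runs_mergeLeaf hP hc hfull hnd
  have le_records : P.l * P.B ≤ (contentsOf out).length := by
    rw [out_perm.length_eq, recordsOf_zero, List.length_append, ← hc.bufferOK.size_eq]
    omega
  have out_ne : out ≠ [] := by
    rintro rfl
    have := hP.B_le
    simp only [contentsOf_nil, List.length_nil] at le_records
    omega
  have split_runs := runs_split (P := P) (by omega) lastKey c.contents.upper out_ne hB
    fun b hb => (out_dense.1 b hb).2
  refine ⟨splitResult P.l lastKey c.contents.upper out, 1 + P.l + c.contents.buf.length +
    o.length + List.length c.contents.body + 2 * out.length + out.length ⌈/⌉ P.l, ?_, ?_,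
    fun r hr => .inl (buf_eq_nil_of_mem_splitResult hr), ?_, ?_⟩
  · have reads : 1 + P.k * P.l + c.contents.buf.length + o.length + List.length c.contents.body +
        out.length ≤ P.k * (1 + P.l + c.contents.buf.length + o.length +
          List.length c.contents.body + 2 * out.length + out.length ⌈/⌉ P.l) := by
      nlinarith
    exact Runs.mono ((runs_load_node c).bind (Runs.ite_neg hsize (sort_runs.bind (o_runs.bind
      (out_runs.bind ((runs_release 1).bind split_runs))))))
  · exact balanced_splitResult_lastKey hl hB out_dense out_sorted
      (fun x hx => hc.le_upper x (out_perm.mem_iff.1 hx)) le_records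
  · rwa [childRecords_splitResult_lastKey (by omega) out_ne]
  · rw [length_splitResult, splitResult, sum_credit_cutNodes_lastKey, add_zero]
    exact credit_splitLeaf_le hP hwt hc hfull o_le out_ne out_dense out_perm

theorem rebalancesTo_splitNode (hP : P.Valid) {v : Tree K (h + 1)} (emptied_eq : v.emptied = true)
    (buf_eq : v.buf = []) (shape : InternalShape P.l h isRoot v)
    {g : Stored (Tree K h) → List (Stored (Tree K h))} {w : Stored (Tree K h) → ℕ}
    {items : List (Stored (Tree K h))} (hitems : (List.map g v.body).flatten = items)
    (hg : ∀ c ∈ (v.body : List (Stored (Tree K h))),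
      RebalancesTo P.l P.B wt (d + 1) h false c.contents (g c) (w c)) :
    items ≠ [] ∧
    RebalancesTo P.l P.B wt d (h + 1) isRoot v (splitResult P.l Node.upper v.upper items)
      ((List.map w v.body).sum + 2 + items.length + items.length ⌈/⌉ P.l) := by
  have hl := hP.le_l
  have balanced := fun c hc => (hg c hc).balanced
  have records_perm := fun c hc => (hg c hc).records_perm
  have separated := shape.separated.flatten (by have := hP.B_le; have := hP.one_le_B; omega)
    balanced records_perm
  have perm := childRecords_flatten_perm records_perm
  have nodeOK := fun r hr => nodeOK_of_mem_flatten balanced (r := r) hr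
  have last_upper := last_upper_flatten balanced shape.last_upper
  obtain ⟨n, length_eq, sum_le⟩ := exists_length_flatten_sum_le
    (f := fun c : Stored (Tree K h) => credit wt (3 * (P.l * P.B)) h c.contents)
    (f' := fun c : Stored (Tree K h) => credit wt (3 * (P.l * P.B)) h c.contents)
    (v.body : List (Stored (Tree K h))) (fun c hc => (balanced c hc).ne_nil)
    fun c hc => (hg c hc).credit_le
  rw [hitems] at separated perm nodeOK last_upper length_eq sum_le
  have two_le := shape.two_le
  have items_ne : items ≠ [] := List.ne_nil_of_length_pos (by omega)
  refine ⟨items_ne, balanced_splitResult_upper hl hP.one_le_B nodeOK separated last_upper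
    (by omega) (fun hroot => by have := shape.le_length hroot; omega),
    fun r hr => .inl (buf_eq_nil_of_mem_splitResult hr), ?_, ?_⟩
  · rwa [childRecords_splitResult_upper (by omega) items_ne, recordsOf_succ, buf_eq,
      contentsOf_nil, List.nil_append]
  · rw [length_splitResult, sum_credit_splitResult_upper wt _ (by omega) items_ne]
    exact credit_splitNode_le hP buf_eq emptied_eq shape.length_le length_eq sum_le

theorem runs_rebalance (hP : P.Valid) {H j : ℕ} (hwt : 12 + H ≤ wt 0) (hH : h + j = H)
    {c : Stored (Tree K h)} (hc : Drained P.l P.B h isRoot c.contents)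
    (hnd : (recordsOf h c.contents).Nodup) :
    ∃ rs w, Runs (rebalance P h c) rs (P.k * w) w 0 (P.M + 6 * P.B) ∧
      RebalancesTo P.l P.B wt (j + 1) h isRoot c.contents rs w := by
  have hB := hP.one_le_B
  have hk := hP.one_le_k
  have hl := hP.le_l
  obtain ⟨v⟩ := c
  change Drained P.l P.B h isRoot v at hc
  change (recordsOf h v).Nodup at hnd
  induction h generalizing j isRoot with
  | zero => cases hc with | leaf receiving => exact runs_rebalance_leaf hP (by omega) receiving hnd
  | succ h ih =>
  cases hc with
  | untouched ok =>
    exact ⟨[⟨v⟩], 1, Runs.mono ((runs_load_node _).bind (Runs.ite_neg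
      (by simp [ok.receiving.bodyOK.1]) ((runs_release 1).bind (Runs.pure _)))), ok.rebalancesTo⟩
  | emptied emptied_eq buf_eq shape children =>
    have records_eq : recordsOf (h + 1) v = childRecords h v.body := by
      rw [recordsOf_succ, buf_eq, contentsOf_nil, List.nil_append]
    rw [records_eq] at hnd
    obtain ⟨g, w, loop_runs, hg⟩ := exists_runs_forEach (f := rebalance P h) (k := P.k)
      (pk := P.M + 6 * P.B) (by omega) (v.body : List (Stored (Tree K h))) fun c hc =>
        ih (j := j + 1) (by omega) c.contents (children c hc) (nodup_of_mem_childRecords hnd hc)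
    obtain ⟨items_ne, rebalancesTo⟩ := rebalancesTo_splitNode hP emptied_eq buf_eq shape rfl hg
    have split_runs := runs_split (P := P) (by omega) Node.upper v.upper items_ne le_rfl
      fun _ _ => le_rfl
    refine ⟨_, _, ?_, rebalancesTo⟩
    set items := (List.map g v.body).flatten
    have reads : 1 + P.k * (List.map w v.body).sum + 1 + items.length ≤
        P.k * ((List.map w v.body).sum + 2 + items.length + items.length ⌈/⌉ P.l) := by
      nlinarith
    exact Runs.mono ((runs_load_node _).bind (Runs.ite_pos emptied_eq (runs_save.bind
      (loop_runs.bind (runs_restore.bind ((runs_release 1).bind split_runs))))))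

end SecondPhase

/-! ### Insertion -/

section Grow

variable {K : Type u} {l B h : ℕ}

theorem grow_succ (P : Params) (n : ℕ) {rs : List (Stored (Tree K h))} (two_le : 2 ≤ rs.length) :
    grow P (n + 1) h rs = split P Node.upper ⊤ rs >>= grow P n (h + 1) := by
  rcases rs with _ | ⟨r, _ | ⟨r', rs⟩⟩
  · simp at two_le
  · simp at two_le
  · rfl

variable [LinearOrder K]

theorem NodeOK.to_root {isRoot : Bool} {v : Tree K h} (hv : NodeOK l B h isRoot v) :
    NodeOK l B h true v := by
  refine nodeOK_iff.2 ⟨⟨hv.receiving.bufferOK, hv.receiving.le_upper, ?_⟩, hv.size_lt⟩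
  have body := hv.receiving.bodyOK
  cases h with
  | zero => exact ⟨body.dense, body.sorted, body.length_le, body.records_le, by simp⟩
  | succ h =>
    obtain ⟨emptied, shape, children⟩ := body
    exact ⟨emptied, ⟨shape.length_le, shape.two_le, by simp, shape.separated, shape.last_upper⟩,
      children⟩

theorem Balanced.nodeOK_root {u : WithTop K} {r : Stored (Tree K h)}
    (hb : Balanced l B h true u [r]) : NodeOK l B h true r.contents := by
  rcases hb.nodeOK with ok | ⟨-, s, hs, ok⟩
  · exact (ok r (List.mem_singleton_self r)).to_root
  · rwa [List.singleton_inj.1 hs]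

theorem Balanced.nodeOK_of_two_le {u : WithTop K} {isRoot : Bool} {rs : List (Stored (Tree K h))}
    (hb : Balanced l B h isRoot u rs) (two_le : 2 ≤ rs.length) :
    ∀ r ∈ rs, NodeOK l B h false r.contents := by
  rcases hb.nodeOK with ok | ⟨-, r, rfl, -⟩
  · exact ok
  · simp at two_le

/-- What putting new roots on top of the nodes `rs` achieves, with `w` block writes. -/
structure GrowsTo (l B : ℕ) (wt : ℕ → ℕ) (e h : ℕ) (rs : List (Stored (Tree K h)))
    (T : BufferTree K) (w : ℕ) : Prop where
  isBufferTree : IsBufferTree l B T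
  tail_eq_nil : T.tail = []
  records_eq : recordsOf T.height T.root.contents = childRecords h rs
  credit_eq : credit wt e T.height T.root.contents =
    (rs.map fun r => credit wt e h r.contents).sum
  writes_le : w ≤ 4 * (rs.length - 1)

theorem runs_grow {P : Params} (hP : P.Valid) (wt : ℕ → ℕ) (e : ℕ) {n : ℕ}
    {rs : List (Stored (Tree K h))} (hn : rs.length ≤ n) (hb : Balanced P.l P.B h true ⊤ rs)
    (hbuf : ∀ r ∈ rs, ∀ b ∈ r.contents.buf, b.contents.length = P.B) :
    ∃ T w, Runs (grow P n h rs) T w w 0 1 ∧ GrowsTo P.l P.B wt e h rs T w := by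
  have hB := hP.one_le_B
  have hl := hP.le_l
  have length_pos := List.length_pos_iff.2 hb.ne_nil
  induction n generalizing h with
  | zero => omega
  | succ n ih =>
    rcases Nat.eq_or_lt_of_le length_pos with length_eq | two_le
    · obtain ⟨r, rfl⟩ := List.length_eq_one_iff.1 length_eq.symm
      exact ⟨⟨[], h, r⟩, 0, Runs.mono (Runs.pure _), ⟨hb.nodeOK_root, hb.last_upper r rfl,
        hbuf r (List.mem_singleton_self r), hB⟩, rfl, by simp, by simp, by simp⟩
    have ceilDiv_lt := ceilDiv_sub_one_mul_lt (l := P.l) (by omega) length_pos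
    have eight_le := Nat.mul_le_mul_left (rs.length ⌈/⌉ P.l - 1) hl
    have length_eq := length_splitResult P.l Node.upper ⊤ rs
    have balanced := balanced_splitResult_upper (isRoot := true) hl hB
      (hb.nodeOK_of_two_le two_le) hb.separated hb.last_upper two_le (by simp)
    obtain ⟨T, w, runs, grows⟩ := ih (by omega) balanced
      (fun r hr b hb => by simp [buf_eq_nil_of_mem_splitResult hr] at hb)
      (List.length_pos_iff.2 balanced.ne_nil)
    have split_runs := runs_split (P := P) (by omega) Node.upper ⊤ hb.ne_nil le_rfl
      fun _ _ => le_rfl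
    have writes_le := grows.writes_le
    refine ⟨T, rs.length + rs.length ⌈/⌉ P.l + w, ?_, grows.isBufferTree, grows.tail_eq_nil,
      ?_, ?_, by omega⟩
    · rw [grow_succ P n two_le]
      exact Runs.mono (split_runs.bind runs)
    · rw [grows.records_eq, childRecords_splitResult_upper (by omega) hb.ne_nil]
    · rw [grows.credit_eq, sum_credit_splitResult_upper wt e (by omega) hb.ne_nil]

end Grow

section Insert

variable {K : Type u} [LinearOrder K]

/-- The credit of a record in a buffer at height `h` of a tree of height at most `H`. -/
def weight (H h : ℕ) : ℕ := 13 * h + (12 + H)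

/-- The potential of a buffer tree of height at most `H`. A record arrives in the tail with credit
`14 H + 16`, which is `4` more than it needs in the buffer of a root at height `H`. -/
def BufferTree.credit (l B H : ℕ) (T : BufferTree K) : ℕ :=
  AEM.credit (weight H) (3 * (l * B)) T.height T.root.contents + (14 * H + 16) * T.tail.length

theorem runs_emptyRoot {P : Params} (hP : P.Valid) {h H : ℕ} (hH : h ≤ H) {c : Stored (Tree K h)}
    (hc : Receiving P.l P.B h true c.contents) (upper_eq : c.contents.upper = ⊤)
    (full : ∀ b ∈ c.contents.buf, b.contents.length = P.B)
    (hnd : (recordsOf h c.contents).Nodup) :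
    ∃ T w,
      Runs (do
        let r' ← emptyDown P h c
        let rs ← rebalance P h r'
        grow P rs.length h rs) T (P.k * w) w 0 (P.M + 6 * P.B) ∧
      IsBufferTree P.l P.B T ∧ T.tail = [] ∧
      (recordsOf T.height T.root.contents).Perm (recordsOf h c.contents) ∧
      P.B * w + T.credit P.l P.B H ≤
        credit (weight H) (3 * (P.l * P.B)) h c.contents + 2 * P.B := by
  have hB := hP.one_le_B
  have hk := hP.one_le_k
  obtain ⟨r', w₁, empty_runs, empties⟩ :=
    runs_emptyDown hP (wt := weight H) (fun h => by simp only [weight]; omega) hc hnd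
  obtain ⟨j, hj⟩ := Nat.exists_eq_add_of_le hH
  obtain ⟨rs, w₂, rebalance_runs, rebalances⟩ :=
    runs_rebalance hP (wt := weight H) (by simp only [weight]; omega) hj.symm empties.drained
      (empties.records_perm.nodup_iff.2 hnd)
  have balanced := rebalances.balanced
  rw [empties.upper_eq, upper_eq] at balanced
  have rs_full : ∀ r ∈ rs, ∀ b ∈ r.contents.buf, b.contents.length = P.B := by
    intro r hr b hb
    rcases rebalances.buf_eq r hr with eq | eq <;> rw [eq] at hb
    · cases hb
    rcases empties.buf_eq with eq' | eq' <;> rw [eq'] at hb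
    · cases hb
    · exact full b hb
  obtain ⟨T, w₃, grow_runs, grows⟩ :=
    runs_grow hP (weight H) (3 * (P.l * P.B)) le_rfl balanced rs_full
  refine ⟨T, w₁ + w₂ + w₃, ?_, grows.isBufferTree, grows.tail_eq_nil, ?_, ?_⟩
  · have reads : P.k * w₁ + P.k * w₂ + w₃ ≤ P.k * (w₁ + w₂ + w₃) := by nlinarith
    exact Runs.mono (empty_runs.bind (rebalance_runs.bind grow_runs))
  · rw [grows.records_eq]
    exact rebalances.records_perm.trans empties.records_perm
  · have grow_le : P.B * w₃ ≤ P.B * (4 * (rs.length - 1)) := Nat.mul_le_mul_left _ grows.writes_le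
    have level_le := Nat.zero_le (4 * P.B * j * (rs.length - 1))
    have empties_le := empties.credit_le
    have rebalances_le := rebalances.credit_le
    simp only [BufferTree.credit, grows.credit_eq, grows.tail_eq_nil, List.length_nil]
    linarith

/-- The root of `T` after the last block of its buffer, completed by `x`, has been written. -/
def BufferTree.pushRoot (B : ℕ) (x : K) (T : BufferTree K) : Tree K T.height :=
  { T.root.contents with
    buf := T.root.contents.buf ++ [⟨T.tail ++ [x]⟩]
    size := T.root.contents.size + B }

variable {l B : ℕ} {x : K} {T : BufferTree K}

theorem IsBufferTree.pushRoot_full (hT : IsBufferTree l B T) (hB : T.tail.length + 1 = B) :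
    ∀ b ∈ (T.pushRoot B x).buf, b.contents.length = B :=
  List.forall_mem_append.2 ⟨hT.2.2.1, by simpa using hB⟩

theorem IsBufferTree.receives_pushRoot (hT : IsBufferTree l B T) (hB : T.tail.length + 1 = B) :
    T.root.contents.Receives B (T.tail ++ [x]) (T.pushRoot B x) := by
  have dense := Dense.append (by omega) (hT.pushRoot_full hB (x := x)) (dense_nil B)
  rw [List.append_nil] at dense
  simpa [BufferTree.pushRoot, hB] using
    Node.Receives.mk _ dense (ys := T.tail ++ [x]) (by simp [BufferTree.pushRoot])

theorem IsBufferTree.size_pushRoot_le (hT : IsBufferTree l B T) :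
    (T.pushRoot B x).size ≤ l * B := by
  have size_eq := hT.1.receiving.bufferOK.size_eq
  rw [length_contentsOf hT.2.2.1] at size_eq
  have size_lt := hT.1.size_lt
  rw [size_eq] at size_lt
  rw [BufferTree.pushRoot, size_eq, ← Nat.succ_mul]
  exact Nat.mul_le_mul_right B (Nat.lt_of_mul_lt_mul_right size_lt)

theorem IsBufferTree.receiving_pushRoot (hT : IsBufferTree l B T) (hB : T.tail.length + 1 = B) :
    Receiving l B T.height true (T.pushRoot B x) := by
  refine hT.1.receives (hT.receives_pushRoot hB) ?_ (by simp [hT.2.1])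
  have size_le := hT.size_pushRoot_le (x := x)
  simp only [BufferTree.pushRoot, hT.1.receiving.bufferOK.size_eq, ← hB] at size_le
  rw [List.drop_eq_nil_of_le (by simpa [← hB] using size_le)]
  exact List.Pairwise.nil

theorem IsBufferTree.records_pushRoot_perm (hT : IsBufferTree l B T)
    (hB : T.tail.length + 1 = B) :
    (recordsOf T.height (T.pushRoot B x)).Perm (T.records ++ [x]) := by
  refine (hT.receives_pushRoot hB).records_perm.trans ?_
  rw [BufferTree.records, ← List.append_assoc]
  exact List.perm_append_comm.append_right _

theorem IsBufferTree.credit_pushRoot_le (hT : IsBufferTree l B T) (hB : T.tail.length + 1 = B)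
    {H : ℕ} (hH : T.height ≤ H) :
    credit (weight H) (3 * (l * B)) T.height (T.pushRoot B x) + 4 * B ≤
      T.credit l B H + (14 * H + 16) := by
  have weight_le : (weight H T.height + 4) * B ≤ (14 * H + 16) * B :=
    Nat.mul_le_mul_right _ (by simp only [weight]; omega)
  rw [(hT.receives_pushRoot hB).credit_eq, List.length_append, List.length_singleton, hB,
    BufferTree.credit]
  rw [add_mul, ← hB] at weight_le
  rw [← hB]
  linarith

/-- What the insertion of `x` into `T` achieves, with `w` block writes. -/
structure InsertsTo (l B H : ℕ) (T : BufferTree K) (x : K) (T' : BufferTree K) (w : ℕ) : Prop where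
  isBufferTree : IsBufferTree l B T'
  records_perm : T'.records.Perm (T.records ++ [x])
  credit_le : B * w + T'.credit l B H ≤ T.credit l B H + (14 * H + 16)

theorem IsBufferTree.insertsTo_tail (hT : IsBufferTree l B T) (hlt : (T.tail ++ [x]).length < B)
    (H : ℕ) : InsertsTo l B H T x { T with tail := T.tail ++ [x] } 0 where
  isBufferTree := ⟨hT.1, hT.2.1, hT.2.2.1, hlt⟩
  records_perm := by
    simp only [BufferTree.records, List.append_assoc]
    exact List.perm_append_comm.append_left _
  credit_le := by
    simp only [BufferTree.credit, List.length_append, List.length_singleton]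
    linarith

theorem IsBufferTree.insertsTo_pushRoot (hT : IsBufferTree l B T) (hB : T.tail.length + 1 = B)
    {H : ℕ} (hH : T.height ≤ H) (hsize : (T.pushRoot B x).size < l * B) :
    InsertsTo l B H T x ⟨[], T.height, ⟨T.pushRoot B x⟩⟩ 2 where
  isBufferTree := ⟨nodeOK_iff.2 ⟨hT.receiving_pushRoot hB, hsize⟩, hT.2.1, hT.pushRoot_full hB,
    by simp only [List.length_nil]; omega⟩
  records_perm := hT.records_pushRoot_perm hB
  credit_le := by
    have push_le := hT.credit_pushRoot_le (x := x) hB hH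
    simp only [BufferTree.credit, List.length_nil] at push_le ⊢
    omega

theorem runs_insert {P : Params} (hP : P.Valid) {H : ℕ} (hT : IsBufferTree P.l P.B T)
    (hnd : (T.records ++ [x]).Nodup) (hH : T.height ≤ H) :
    ∃ T' w, Runs (insert P x T) T' (P.k * w) w ((T'.tail.length : ℤ) - T.tail.length)
      (P.M + 6 * P.B - T.tail.length) ∧ InsertsTo P.l P.B H T x T' w := by
  have hk := hP.one_le_k
  have tail_lt := hT.2.2.2
  by_cases hlt : (T.tail ++ [x]).length < P.B
  · refine ⟨_, 0, ?_, hT.insertsTo_tail hlt H⟩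
    refine Runs.mono ((runs_occupy 1).bind (Runs.ite_pos hlt (Runs.pure _))) (hd := ?_)
    simp only [List.length_append, List.length_singleton]
    omega
  have hfull : T.tail.length + 1 = P.B := by
    rw [List.length_append, List.length_singleton] at hlt
    omega
  by_cases hsize : (T.pushRoot P.B x).size < P.l * P.B
  · refine ⟨_, 2, ?_, hT.insertsTo_pushRoot hfull hH hsize⟩
    refine Runs.mono ((runs_occupy 1).bind (Runs.ite_neg hlt ((runs_store_block _).bind
      ((runs_load_node _).bind ((runs_store_node _).bind (Runs.ite_pos hsize (Runs.pure _)))))))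
      (hd := ?_) (hpk := ?_)
    all_goals simp only [List.length_append, List.length_singleton, List.length_nil]; omega
  obtain ⟨T', w, runs, isBufferTree, tail_eq, perm, credit_le⟩ := runs_emptyRoot hP hH
    (c := ⟨T.pushRoot P.B x⟩) (hT.receiving_pushRoot hfull) hT.2.1 (hT.pushRoot_full hfull)
    ((hT.records_pushRoot_perm hfull).nodup_iff.2 hnd)
  refine ⟨T', 2 + w, ?_, isBufferTree, ?_, ?_⟩
  · have reads : 1 + P.k * w ≤ P.k * (2 + w) := by nlinarith
    refine Runs.mono ((runs_occupy 1).bind (Runs.ite_neg hlt ((runs_store_block _).bind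
      ((runs_load_node _).bind ((runs_store_node _).bind (Runs.ite_neg hsize runs))))))
      (hd := ?_) (hpk := ?_)
    all_goals simp only [tail_eq, List.length_append, List.length_singleton, List.length_nil]; omega
  · rw [BufferTree.records, tail_eq, List.nil_append]
    exact perm.trans (hT.records_pushRoot_perm hfull)
  · have push_le := hT.credit_pushRoot_le (x := x) hfull hH
    dsimp only at credit_le
    linarith

theorem runs_insertAll {P : Params} (hP : P.Valid) {n H : ℕ}
    (hH : ∀ T : BufferTree K, IsBufferTree P.l P.B T → T.records.length ≤ n → T.height ≤ H)
    {xs : List K} (hT : IsBufferTree P.l P.B T) (hnd : (T.records ++ xs).Nodup)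
    (hn : (T.records ++ xs).length ≤ n) :
    ∃ T' w, Runs (insertAll P xs T) T' (P.k * w) w ((T'.tail.length : ℤ) - T.tail.length)
        (P.M + 6 * P.B - T.tail.length) ∧
      IsBufferTree P.l P.B T' ∧ T'.records.Perm (T.records ++ xs) ∧
      P.B * w + T'.credit P.l P.B H ≤ T.credit P.l P.B H + (14 * H + 16) * xs.length := by
  have tail_lt := hT.2.2.2
  induction xs generalizing T with
  | nil => exact ⟨T, 0, Runs.mono (Runs.pure _), hT, by simp, by simp⟩
  | cons x xs ih =>
    have records_eq : T.records ++ x :: xs = T.records ++ [x] ++ xs := by simp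
    rw [records_eq] at hnd hn ⊢
    obtain ⟨T₁, w₁, insert_runs, inserts⟩ := runs_insert hP hT hnd.of_append_left
      (hH T hT (by rw [List.length_append, List.length_append] at hn; omega))
    have perm := inserts.records_perm.append_right xs
    obtain ⟨T', w, all_runs, isBufferTree, perm', credit_le⟩ := ih inserts.isBufferTree
      (perm.nodup_iff.2 hnd) (perm.length_eq ▸ hn) inserts.isBufferTree.2.2.2
    refine ⟨T', w₁ + w, ?_, isBufferTree, perm'.trans perm, ?_⟩
    · have reads : P.k * w₁ + P.k * w ≤ P.k * (w₁ + w) := (mul_add _ _ _).ge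
      exact Runs.mono (insert_runs.bind all_runs)
    · have insert_le := inserts.credit_le
      rw [List.length_cons]
      linarith

end Insert

section Height

variable {K : Type u}

theorem length_mul_le_childRecords {h a b : ℕ} {cs : List (Stored (Tree K h))}
    (hc : ∀ c ∈ cs, a ≤ b * (recordsOf h c.contents).length) :
    cs.length * a ≤ b * (childRecords h cs).length := by
  induction cs with
  | nil => simp
  | cons c cs ih =>
    obtain ⟨head, tail⟩ := List.forall_mem_cons.1 hc
    rw [childRecords_cons, List.length_append, List.length_cons, mul_add, Nat.succ_mul]
    have := ih tail
    omega

variable [LinearOrder K] {l B h : ℕ}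

theorem NodeOK.pow_mul_le {v : Tree K h} (hv : NodeOK l B h false v) :
    l ^ (h + 1) * B ≤ 4 ^ (h + 1) * (recordsOf h v).length := by
  induction h with
  | zero =>
    have le_records := hv.receiving.bodyOK.le_records rfl
    rw [recordsOf_zero, List.length_append, zero_add, pow_one, pow_one]
    omega
  | succ h ih =>
    obtain ⟨-, shape, children⟩ := hv.receiving.bodyOK
    have children_le := length_mul_le_childRecords fun c hc => ih (children c hc)
    rw [recordsOf_succ, List.length_append]
    calc l ^ (h + 1 + 1) * B = l * (l ^ (h + 1) * B) := by ring
      _ ≤ 4 * List.length v.body * (l ^ (h + 1) * B) := Nat.mul_le_mul_right _ (shape.le_length rfl)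
      _ = 4 * (List.length v.body * (l ^ (h + 1) * B)) := mul_assoc _ _ _
      _ ≤ 4 * (4 ^ (h + 1) * (childRecords h v.body).length) := Nat.mul_le_mul_left _ children_le
      _ = 4 ^ (h + 1 + 1) * (childRecords h v.body).length := by ring
      _ ≤ _ := Nat.mul_le_mul_left _ (Nat.le_add_left _ _)

theorem NodeOK.pow_le_of_root (hB : 1 ≤ B) {isRoot : Bool} {v : Tree K (h + 1)}
    (hv : NodeOK l B (h + 1) isRoot v) :
    l ^ (h + 1) ≤ 4 ^ (h + 1) * (recordsOf (h + 1) v).length := by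
  obtain ⟨-, shape, children⟩ := hv.receiving.bodyOK
  have two_le := shape.two_le
  have children_le := length_mul_le_childRecords fun c hc => (children c hc).pow_mul_le
  rw [recordsOf_succ, List.length_append]
  calc l ^ (h + 1) = 1 * (l ^ (h + 1) * 1) := by ring
    _ ≤ List.length v.body * (l ^ (h + 1) * B) :=
        Nat.mul_le_mul (by omega) (Nat.mul_le_mul_left _ hB)
    _ ≤ 4 ^ (h + 1) * (childRecords h v.body).length := children_le
    _ ≤ _ := Nat.mul_le_mul_left _ (Nat.le_add_left _ _)

theorem logb_natCast_nonneg (l n : ℕ) : 0 ≤ Real.logb l n :=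
  div_nonneg (Real.log_natCast_nonneg n) (Real.log_natCast_nonneg l)

/-- Since `4 ^ 3 ≤ l ^ 2`, the base `l / 4` is at least `l ^ (1/3)`. -/
theorem le_three_mul_logb {n : ℕ} (hl : 8 ≤ l) (hp : l ^ h ≤ 4 ^ h * n) :
    (h : ℝ) ≤ 3 * Real.logb l n := by
  have hl' : (8 : ℝ) ≤ l := by exact_mod_cast hl
  have hn : n ≠ 0 := by
    rintro rfl
    have : 0 < l ^ h := by positivity
    omega
  have log_pos : 0 < Real.log l := Real.log_pos (by linarith)
  have log_four_le : 3 * Real.log 4 ≤ 2 * Real.log l := by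
    have := Real.log_le_log (by norm_num) (show (4 : ℝ) ^ 3 ≤ (l : ℝ) ^ 2 by nlinarith)
    simpa only [Real.log_pow, Nat.cast_ofNat] using this
  have mul_log_le : h * Real.log l ≤ h * Real.log 4 + Real.log n := by
    have := Real.log_le_log (by positivity) (show (l : ℝ) ^ h ≤ 4 ^ h * n by exact_mod_cast hp)
    rwa [Real.log_mul (by positivity) (by positivity), Real.log_pow, Real.log_pow] at this
  rw [Real.logb, ← mul_div_assoc, le_div_iff₀ log_pos]
  nlinarith [mul_le_mul_of_nonneg_left log_four_le h.cast_nonneg]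

theorem IsBufferTree.height_le (hl : 8 ≤ l) (hB : 1 ≤ B) {T : BufferTree K}
    (hT : IsBufferTree l B T) {n : ℕ} (hn : T.records.length ≤ n) :
    (T.height : ℝ) ≤ 3 * Real.logb l n := by
  obtain ⟨tail, _ | h, ⟨v⟩⟩ := T
  · simpa using logb_natCast_nonneg l n
  rw [BufferTree.records, List.length_append] at hn
  exact le_three_mul_logb hl ((hT.1.pow_le_of_root hB).trans
    (Nat.mul_le_mul_left _ ((Nat.le_add_left _ _).trans hn)))

end Height

section Cost

variable {K : Type u} [LinearOrder K] {P : Params}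

theorem isBufferTree_empty (hP : P.Valid) : IsBufferTree P.l P.B (BufferTree.empty K) := by
  refine ⟨nodeOK_iff.2 ⟨⟨⟨dense_nil _, rfl, by simp [BufferTree.empty]⟩, ?_, dense_nil _,
    List.Pairwise.nil, Nat.zero_le _, Nat.zero_le _, by simp⟩, ?_⟩, rfl, ?_, hP.one_le_B⟩
  · simp [BufferTree.empty, recordsOf_zero]
  · exact Nat.mul_pos (by have := hP.le_l; omega) hP.one_le_B
  · simp [BufferTree.empty]

theorem exists_runs_insertAll_empty (hP : P.Valid) {xs : List K} (hnd : xs.Nodup) :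
    ∃ T w, Runs (insertAll P xs (BufferTree.empty K)) T (P.k * w) w T.tail.length
        (P.M + 6 * P.B) ∧
      IsBufferTree P.l P.B T ∧ T.records.Perm xs ∧
      (w : ℝ) ≤ 48 * (xs.length * (1 / P.B * (1 + Real.logb P.l xs.length))) := by
  set H := ⌊3 * Real.logb P.l xs.length⌋₊
  have log_nonneg := logb_natCast_nonneg P.l xs.length
  have H_le : (H : ℝ) ≤ 3 * Real.logb P.l xs.length := Nat.floor_le (by positivity)
  obtain ⟨T, w, runs, isBufferTree, perm, credit_le⟩ := runs_insertAll hP (H := H)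
    (fun T hT hn => Nat.le_floor (hT.height_le hP.le_l hP.one_le_B hn)) (isBufferTree_empty hP)
    (xs := xs) hnd le_rfl
  refine ⟨T, w, Runs.mono runs (hd := ?_) (hpk := ?_), isBufferTree, perm, ?_⟩
  · simp [BufferTree.empty]
  · simp [BufferTree.empty]
  have credit_empty : (BufferTree.empty K).credit P.l P.B H = 0 := rfl
  have writes_le : P.B * w ≤ (14 * H + 16) * xs.length := by omega
  have writes_le' : (w : ℝ) * P.B ≤ (14 * H + 16) * xs.length := by
    rw [mul_comm]
    exact_mod_cast writes_le
  have hB : (0 : ℝ) < P.B := by exact_mod_cast hP.one_le_B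
  calc (w : ℝ) ≤ (14 * H + 16) * xs.length / P.B := (le_div_iff₀ hB).2 writes_le'
    _ ≤ 48 * (1 + Real.logb P.l xs.length) * xs.length / P.B := by gcongr; linarith
    _ = _ := by ring

end Cost

end AEM

/-- Amortized cost of insertion: `n` insertions of distinct keys into the initially empty buffer
tree with branching factor `kM/B` cost `O(n (k/B) (1 + log_{kM/B} n))` reads and
`O(n (1/B) (1 + log_{kM/B} n))` writes, in primary memory of size `O(M)`. -/
theorem mainTheorem5 :
    ∃ C : ℝ, 0 < C ∧
      ∀ (K : Type u) [LinearOrder K] (k M B : ℕ), 1 ≤ k → 1 ≤ B → B ∣ M → 8 * B ≤ k * M →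
        ∀ xs : List K, xs.Nodup →
          ∀ (T : AEM.BufferTree K) (m : AEM.Meter),
            AEM.insertAll ⟨k, M, B⟩ xs (AEM.BufferTree.empty K) AEM.Meter.zero = (T, m) →
            AEM.IsBufferTree (k * M / B) B T ∧
            T.records.Perm xs ∧
            (m.reads : ℝ) ≤ C * (xs.length *
              (((k : ℝ) / B) * (1 + Real.logb ((k : ℝ) * M / B) xs.length))) ∧
            (m.writes : ℝ) ≤ C * (xs.length *
              ((1 / (B : ℝ)) * (1 + Real.logb ((k : ℝ) * M / B) xs.length))) ∧
            m.held = T.tail.length ∧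
            (m.peak : ℝ) ≤ C * M := by
  refine ⟨48, by norm_num, ?_⟩
  intro K _ k M B hk hB hBM hkM xs hnd T m hrun
  have hP : AEM.Params.Valid ⟨k, M, B⟩ := ⟨hk, hB, hBM, (Nat.le_div_iff_mul_le hB).2 hkM⟩
  obtain ⟨T', w, runs, isBufferTree, perm, writes_le⟩ := AEM.exists_runs_insertAll_empty hP hnd
  obtain ⟨rfl, reads, writes, held, peak⟩ := hrun ▸ runs AEM.Meter.zero
  have l_eq : (k : ℝ) * M / B = (k * M / B : ℕ) := by
    rw [Nat.cast_div (hBM.mul_left k) (by positivity), Nat.cast_mul]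
  rw [l_eq]
  have reads' : (m.reads : ℝ) ≤ k * w := by
    exact_mod_cast reads.trans_eq (Nat.zero_add _)
  have writes' : (m.writes : ℝ) ≤ w := by
    exact_mod_cast writes.trans_eq (Nat.zero_add _)
  refine ⟨isBufferTree, perm, ?_, writes'.trans writes_le, held.trans (zero_add _), ?_⟩
  · calc (m.reads : ℝ) ≤ k * w := reads'
      _ ≤ k * _ := mul_le_mul_of_nonneg_left writes_le k.cast_nonneg
      _ = _ := by simp only [AEM.Params.l]; ring
  · have B_le : (B : ℤ) ≤ M := by exact_mod_cast hP.B_le_M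
    have peak' : m.peak ≤ 48 * M := by
      simp only [AEM.Meter.zero] at peak
      omega
    exact_mod_cast peak'
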